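/- **Corollary 1.** Let $\gamma$ be Euler's constant, $d_n=\operatorname{lcm}(1,\dots,n)$ (with $d_0=1$), and $\{x\}=x-\lfloor x\rfloor$. For integers $0\le m\le n$ put $$L_{n,m}=\sum_{k=0}^n\binom nk\binom{n+k}k(-1)^{n+k}\ln(n-m+k+1).$$ For $n\ge 0$ let $$[n/n]_t=\frac{t\sum_{k=0}^n\binom nk\binom{n+k}k\sum_{i=0}^{k-1}\frac{(-1)^i\,t^{\,n-k+i}}{i+1}}{\sum_{k=0}^n\binom nk\binom{n+k}k\,t^{\,n-k}},$$ and, whenever $n-m+1=2^p$ with an integer $p\ge 0$, define the rational number $$\tilde L_{n,m}=p\,[n/n]_{t=1}+\sum_{k=0}^n\binom nk\binom{n+k}k(-1)^{n+k}\,[n/n]_{t=k/(n-m+1)}.$$ Then: 1. For every $n\ge0$, $[n/n]_t$ is the $[n/n]$ Padé approximant of $\ln(1+t)$ at $t=0$: its displayed numerator and denominator are polynomials of degree at most $n$, the denominator does not vanish at $0$, and $\ln(1+t)-[n/n]_t=O(t^{2n+1})$ as $t\to0$. 2. For every fixed integer $m\ge 0$ and all sufficiently large $p$, with $n=2^p+m-1$,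 one has $|L_{n,m}-\tilde L_{n,m}|\le 4^{-n}/n$. For $m\in\{0,1\}$ this holds for all $p\ge0$ for which $n\ge1$. 3. Let $m\ge 0$ be an integer. If the sequence $\bigl\{d_{2^p+m-1}\,(-1)^m\,\tilde L_{2^p+m-1,m}\bigr\}$ does not converge to $0$ as $p\to\infty$, then $\gamma$ is irrational. For $m\in\{0,1\}$ the same is true with $d_{2^p}$ in place of $d_{2^p+m-1}$. -/

import Mathlib

open Filter Topology

/-- `d_n = lcm(1, …, n)` (with `d_0 = 1`). -/
def lcmUpTo (n : ℕ) : ℕ := (Finset.Icc 1 n).lcm id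

/-- The linear form in logarithms
`L_{n,m} = ∑_{k=0}^n C(n,k) C(n+k,k) (-1)^{n+k} ln(n-m+k+1)`, for `m ≤ n`. -/
noncomputable def logForm (n m : ℕ) : ℝ :=
  ∑ k ∈ Finset.range (n + 1),
    (n.choose k : ℝ) * ((n + k).choose k : ℝ) * (-1) ^ (n + k) *
      Real.log ((n : ℝ) - (m : ℝ) + (k : ℝ) + 1)

/-- The rational function `N / D` is the Padé approximant `[a/b]` of `f` at `0`:
`deg N ≤ a`, `deg D ≤ b`, `D(0) ≠ 0` and `f(t) - N(t)/D(t) = O(t^{a+b+1})` as `t → 0`. -/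
def IsPadeApproximant (f : ℝ → ℝ) (a b : ℕ) (N D : Polynomial ℝ) : Prop :=
  N.natDegree ≤ a ∧ D.natDegree ≤ b ∧ D.eval 0 ≠ 0 ∧
    (fun t : ℝ => f t - N.eval t / D.eval t) =O[𝓝 0] (fun t : ℝ => t ^ (a + b + 1))

/-- Numerator of `[n/n]`:
`t ∑_{k=0}^n C(n,k) C(n+k,k) ∑_{i=0}^{k-1} (-1)^i t^{n-k+i} / (i+1)`. -/
noncomputable def padeNum (n : ℕ) : Polynomial ℚ :=
  Polynomial.X * ∑ k ∈ Finset.range (n + 1),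
    Polynomial.C ((n.choose k : ℚ) * ((n + k).choose k : ℚ)) *
      ∑ i ∈ Finset.range k,
        Polynomial.C ((-1 : ℚ) ^ i / ((i : ℚ) + 1)) * Polynomial.X ^ (n - k + i)

/-- Denominator of `[n/n]`: `∑_{k=0}^n C(n,k) C(n+k,k) t^{n-k}`.
It is positive at every `t ≥ 0`. -/
noncomputable def padeDen (n : ℕ) : Polynomial ℚ :=
  ∑ k ∈ Finset.range (n + 1),
    Polynomial.C ((n.choose k : ℚ) * ((n + k).choose k : ℚ)) * Polynomial.X ^ (n - k)

/-- The value `[n/n]_t` at a rational point `t ≥ 0`. -/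
noncomputable def padeLog (n : ℕ) (t : ℚ) : ℚ :=
  (padeNum n).eval t / (padeDen n).eval t

/-- The rational number
`L̃_{n,m} = p [n/n]_{t=1} + ∑_{k=0}^n C(n,k) C(n+k,k) (-1)^{n+k} [n/n]_{t=k/(n-m+1)}`,
where `n - m + 1 = 2^p`. -/
noncomputable def ratForm (n m p : ℕ) : ℚ :=
  (p : ℚ) * padeLog n 1 +
    ∑ k ∈ Finset.range (n + 1),
      (n.choose k : ℚ) * ((n + k).choose k : ℚ) * (-1) ^ (n + k) *
        padeLog n ((k : ℚ) / ((n : ℚ) - (m : ℚ) + 1))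

/-!
The whole argument is governed by the shifted Legendre polynomial
`S(x) = ∑_k (-1)^k C(n,k) C(n+k,k) x^k` on `[0, 1]`, whose coefficients are those of every linear
form in the theorem. By Rodrigues' formula, `n` integrations by parts move all derivatives off
`S` (`factorial_mul_integral_legendreSum_mul`).

*Padé approximation.* Let `N` and `D` be the displayed numerator and denominator. Then
`D(t) ln (1 + t) - N(t) = t^(n+1) ∫ S(x) / (1 + t x) dx`, and integrating by parts turns this into
`t^(2n+1) ∫ x^n (1-x)^n / (1 + t x)^(n+1) dx` (`padeDen_mul_log_sub_padeNum`). This gives the order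
of contact at `0`. For `0 ≤ t ≤ 1` it also bounds the error `ln (1 + t) - N(t) / D(t)`: it is
non-negative, and at most `ln 2 (9/50)^n` divided by the sum of the coefficients
`C(n,k) C(n+k,k)`. Since `ln (2^p + k) = p ln 2 + ln (1 + k / 2^p)` and the signed coefficients add
up to `1`, the difference `L - L̃` is a combination of such errors, hence `O((9/50)^n)`. For fixed
`m` the nodes exceed `1` by at most `1 / 20` eventually, which worsens the base to `189 / 1000`,
still below `1 / 5`.

*Euler's constant.* With `g_y(x) = (1 - x^y) / (1 - x)`, telescoping in `M` shows
`∫∫ x^M g_y(x) dx dy = γ - H_M + ln (M + 1)` (`eulerMoment_eq`), and summing against the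
coefficients gives `γ + L_{n,m} - A_n = R_{n,m}`, where
`R_{n,m} = (-1)^n ∫∫ x^(n-m) S(x) g_y(x) dx dy`.
Orthogonality of `S` to lower degrees makes `A_n = ∑_k (-1)^(n+k) C(n,k) C(n+k,k) H_k` independent
of `m`, so that `d_n A_n` is an integer.

*Sign and size of the remainder.* The function `g_y` is a Stieltjes transform,
`g_y(x) = C_y ∫_0^∞ s^y / ((1 + s) (x + s)) ds`. Under `∫ S(x) / (x + s) dx` the factor `x^(n-m)`
becomes `(-s)^(n-m)`, and so `(-1)^m R_{n,m}` is a triple integral of a positive function. It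
follows that `c 5^(-n) ≤ (-1)^m R_{n,m} ≤ 4^(m-n)` with some `c > 0` depending on `m`
(`exists_le_eulerRemainder`, `eulerRemainder_le`).

*The criterion.* If `γ` is rational then, for large `n`, `d_n (-1)^m L̃` differs from an integer by
`d_n ((-1)^m R + (-1)^m (L̃ - L))`. This is non-negative because `189 / 1000 < 1 / 5`, and it tends
to `0` because `d_n = O((7/2)^n)` (`exists_lcmUpTo_le`, by a Chebyshev argument with the
multinomial coefficients `(6k)! / ((3k)! (2k)! k!)`). So the fractional parts tend to `0`.
-/

open scoped Nat Polynomial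
open MeasureTheory

/-! ### Legendre polynomials and integration by parts -/

/-- The polynomial function `∑_k (-1)^k C(n,k) C(n+k,k) x^k`, i.e. the shifted Legendre polynomial
normalised by the value `1` at `0`. -/
noncomputable def legendreSum (n : ℕ) (x : ℝ) : ℝ :=
  ∑ k ∈ Finset.range (n + 1), (n.choose k : ℝ) * ((n + k).choose k : ℝ) * (-1) ^ k * x ^ k

lemma legendreSum_eq_aeval (n : ℕ) (x : ℝ) :
    legendreSum n x = Polynomial.aeval x (Polynomial.shiftedLegendre n) := by
  unfold legendreSum Polynomial.shiftedLegendre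
  rw [map_sum]
  refine Finset.sum_congr rfl fun k _ => ?_
  have h : (n + k).choose k = (n + k).choose n := by
    rw [Nat.choose_symm_add]
  rw [h]
  simp only [map_mul, map_pow, Polynomial.aeval_X, map_natCast, map_neg, map_one]
  ring

lemma continuous_legendreSum (n : ℕ) : Continuous (legendreSum n) := by
  unfold legendreSum
  fun_prop

/-- The coefficients `(-1)^(n+k) C(n,k) C(n+k,k)` add up to `1`. -/
lemma sum_signed_coeff_eq_one (n : ℕ) :
    ∑ k ∈ Finset.range (n + 1),
      (n.choose k : ℝ) * ((n + k).choose k : ℝ) * (-1) ^ (n + k) = 1 := by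
  have h1 : legendreSum n 1 = (-1) ^ n := by
    rw [legendreSum_eq_aeval, Polynomial.shiftedLegendre_eval_symm, sub_self,
      ← legendreSum_eq_aeval]
    have : legendreSum n 0 = 1 := by
      unfold legendreSum
      rw [Finset.sum_eq_single 0]
      · simp
      · intro b _ hb; simp [hb]
      · simp
    rw [this, mul_one]
  calc _ = (-1) ^ n * legendreSum n 1 := by
        unfold legendreSum
        rw [Finset.mul_sum]
        refine Finset.sum_congr rfl fun k _ => ?_
        rw [pow_add]; ring
    _ = 1 := by rw [h1, ← mul_pow]; norm_num

/-- The polynomial `X^n (1 - X)^n` of Rodrigues' formula. -/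
noncomputable def rodriguesPoly (n : ℕ) : ℝ[X] :=
  Polynomial.X ^ n * (1 - Polynomial.X) ^ n

lemma eval_rodriguesPoly (n : ℕ) (x : ℝ) : (rodriguesPoly n).eval x = x ^ n * (1 - x) ^ n := by
  simp [rodriguesPoly]

lemma factorial_mul_legendreSum (n : ℕ) (x : ℝ) :
    (n ! : ℝ) * legendreSum n x = (Polynomial.derivative^[n] (rodriguesPoly n)).eval x := by
  have h := congrArg (Polynomial.aeval x) (Polynomial.factorial_mul_shiftedLegendre_eq n)
  rw [map_mul, ← legendreSum_eq_aeval] at h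
  have h2 : rodriguesPoly n = (Polynomial.X ^ n * (1 - (Polynomial.X : ℤ[X])) ^ n).map
      (Int.castRingHom ℝ) := by
    simp [rodriguesPoly]
  rw [h2, Polynomial.iterate_derivative_map, Polynomial.eval_map, ← algebraMap_int_eq,
    ← Polynomial.aeval_def, ← h]
  simp

/-- The derivatives of `X^n (1 - X)^n` of order below `n` vanish at both ends of `[0, 1]`. -/
lemma eval_iterate_derivative_rodriguesPoly (n k : ℕ) (hk : k < n) :
    (Polynomial.derivative^[k] (rodriguesPoly n)).eval 0 = 0 ∧
    (Polynomial.derivative^[k] (rodriguesPoly n)).eval 1 = 0 := by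
  have h : (Polynomial.X * (1 - Polynomial.X) : ℝ[X]) ^ (n - k) ∣
      Polynomial.derivative^[k] (rodriguesPoly n) := by
    rw [rodriguesPoly, ← mul_pow]
    exact Polynomial.pow_sub_dvd_iterate_derivative_pow _ _ _
  obtain ⟨q, hq⟩ := h
  have : n - k ≠ 0 := by omega
  rw [hq]
  simp [this]

/-- `n`-fold integration by parts against the Legendre polynomial. -/
lemma factorial_mul_integral_legendreSum_mul (n : ℕ) (f : ℕ → ℝ → ℝ)
    (hf : ∀ j, ∀ x ∈ Set.Icc (0 : ℝ) 1, HasDerivAt (f j) (f (j + 1) x) x) :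
    (n ! : ℝ) * ∫ x in (0 : ℝ)..1, legendreSum n x * f 0 x =
      (-1) ^ n * ∫ x in (0 : ℝ)..1, x ^ n * (1 - x) ^ n * f n x := by
  have hc : ∀ j, ContinuousOn (f j) (Set.uIcc 0 1) := fun j x hx =>
    (hf j x (by rwa [Set.uIcc_of_le zero_le_one] at hx)).continuousAt.continuousWithinAt
  have key : ∀ k ≤ n, ∀ j, ∫ x in (0 : ℝ)..1,
      (Polynomial.derivative^[k] (rodriguesPoly n)).eval x * f j x =
      (-1) ^ k * ∫ x in (0 : ℝ)..1, (rodriguesPoly n).eval x * f (j + k) x := by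
    intro k
    induction k with
    | zero => intro _ j; simp
    | succ k ih =>
      intro hk j
      have hb := eval_iterate_derivative_rodriguesPoly n k (by omega)
      have := intervalIntegral.integral_mul_deriv_eq_deriv_mul (a := 0) (b := 1)
        (u := f j) (u' := f (j + 1))
        (v := fun x => (Polynomial.derivative^[k] (rodriguesPoly n)).eval x)
        (v' := fun x => (Polynomial.derivative^[k + 1] (rodriguesPoly n)).eval x)
        (fun x hx => hf j x (by rwa [Set.uIcc_of_le zero_le_one] at hx))
        (fun x _ => by
          rw [Function.iterate_succ_apply']
          exact Polynomial.hasDerivAt _ x)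
        ((hc (j + 1)).intervalIntegrable)
        ((Polynomial.continuous _).intervalIntegrable _ _)
      simp only [hb.1, hb.2, mul_zero, sub_zero, zero_sub] at this
      have e := ih (by omega) (j + 1)
      calc _ = ∫ x in (0 : ℝ)..1,
            f j x * (Polynomial.derivative^[k + 1] (rodriguesPoly n)).eval x := by
            simp only [mul_comm]
        _ = -∫ x in (0 : ℝ)..1,
            (Polynomial.derivative^[k] (rodriguesPoly n)).eval x * f (j + 1) x := by
            rw [this]; simp only [mul_comm]
        _ = _ := by
            rw [e, pow_succ, add_right_comm, add_assoc]
            ring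
  have := key n le_rfl 0
  simp only [← factorial_mul_legendreSum, eval_rodriguesPoly, zero_add] at this
  rw [← this, ← intervalIntegral.integral_const_mul]
  simp only [mul_assoc]

/-- The Legendre polynomial is orthogonal to the monomials of lower degree. -/
lemma integral_legendreSum_mul_pow (n i : ℕ) (hi : i < n) :
    ∫ x in (0 : ℝ)..1, legendreSum n x * x ^ i = 0 := by
  have h := factorial_mul_integral_legendreSum_mul n
    (fun j x => (Polynomial.derivative^[j] (Polynomial.X ^ i : ℝ[X])).eval x)
    (fun j x _ => by
      rw [Function.iterate_succ_apply']
      exact Polynomial.hasDerivAt _ x)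
  have h0 : Polynomial.derivative^[n] (Polynomial.X ^ i : ℝ[X]) = 0 :=
    Polynomial.iterate_derivative_eq_zero (by simpa using hi)
  simp only [h0, Polynomial.eval_zero, mul_zero, intervalIntegral.integral_zero,
    Function.iterate_zero, id, Polynomial.eval_pow, Polynomial.eval_X] at h
  exact (mul_eq_zero.mp h).resolve_left (by positivity)

lemma one_add_mul_pos {t x : ℝ} (ht : -1 < t) (hx : x ∈ Set.Icc (0 : ℝ) 1) : 0 < 1 + t * x := by
  obtain ⟨h0, h1⟩ := hx
  rcases h1.lt_or_eq with h | rfl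
  · nlinarith
  · linarith

/-- The Stieltjes transform of the Legendre polynomial. -/
lemma integral_legendreSum_div (n : ℕ) {t : ℝ} (ht : -1 < t) :
    ∫ x in (0 : ℝ)..1, legendreSum n x / (1 + t * x) =
      t ^ n * ∫ x in (0 : ℝ)..1, x ^ n * (1 - x) ^ n / (1 + t * x) ^ (n + 1) := by
  have h := factorial_mul_integral_legendreSum_mul n
    (fun j x => (-1) ^ j * (j ! : ℝ) * t ^ j / (1 + t * x) ^ (j + 1))
    (fun j x hx => by
      have hpos := one_add_mul_pos ht hx
      have h1 : HasDerivAt (fun x : ℝ => 1 + t * x) t x := by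
        simpa using ((hasDerivAt_id x).const_mul t).const_add 1
      have h2 := ((h1.pow (j + 1)).inv (by simpa using (pow_pos hpos (j + 1)).ne')).const_mul
        ((-1) ^ j * (j ! : ℝ) * t ^ j)
      refine (h2.congr_deriv ?_).congr_of_eventuallyEq ?_
      · simp only [Nat.factorial_succ]
        push_cast
        field_simp
        simp
        ring
      · exact Eventually.of_forall fun y => by simp [div_eq_mul_inv])
  have hn : (n ! : ℝ) ≠ 0 := by positivity
  apply mul_left_cancel₀ hn
  convert h using 1
  · simp [div_eq_mul_inv]
  · rw [← mul_assoc, ← intervalIntegral.integral_const_mul, ← intervalIntegral.integral_const_mul]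
    congr 1
    ext x
    have : ((-1 : ℝ) ^ n) * (-1) ^ n = 1 := by rw [← mul_pow]; norm_num
    linear_combination (-(n ! : ℝ) * t ^ n * (x ^ n * (1 - x) ^ n / (1 + t * x) ^ (n + 1))) * this

/-! ### The Padé approximant of the logarithm -/

/-- Subtracting a Taylor polynomial from `ln (1 + t)` leaves the integral of the remainder of a
geometric series. -/
lemma log_sub_taylor_eq_integral {t : ℝ} (ht : -1 < t) (k : ℕ) :
    Real.log (1 + t) - ∑ i ∈ Finset.range k, (-1) ^ i * t ^ (i + 1) / ((i : ℝ) + 1) =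
      t ^ (k + 1) * ∫ x in (0 : ℝ)..1, (-1) ^ k * x ^ k / (1 + t * x) := by
  have hpos : ∀ x ∈ Set.uIcc (0 : ℝ) 1, 0 < 1 + t * x := fun x hx =>
    one_add_mul_pos ht (by rwa [Set.uIcc_of_le zero_le_one] at hx)
  have hcont : ∀ j : ℕ, IntervalIntegrable (fun x : ℝ => (-1) ^ j * x ^ j / (1 + t * x))
      MeasureTheory.volume 0 1 := fun j => by
    apply ContinuousOn.intervalIntegrable
    exact ContinuousOn.div (by fun_prop) (by fun_prop) fun x hx => (hpos x hx).ne'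
  induction k with
  | zero =>
    have h : ∫ x in (0 : ℝ)..1, t * (1 / (1 + t * x)) = Real.log (1 + t) := by
      have := intervalIntegral.integral_eq_sub_of_hasDerivAt
        (f := fun x : ℝ => Real.log (1 + t * x)) (f' := fun x => t * (1 / (1 + t * x)))
        (a := 0) (b := 1)
        (fun x hx => by
          have h1 : HasDerivAt (fun x : ℝ => 1 + t * x) t x := by
            simpa using ((hasDerivAt_id x).const_mul t).const_add 1
          exact (h1.log (hpos x hx).ne').congr_deriv (by ring))
        (by simpa using (hcont 0).const_mul t)
      simpa using this
    rw [intervalIntegral.integral_const_mul] at h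
    simp only [Finset.range_zero, Finset.sum_empty, sub_zero, zero_add, pow_one, pow_zero, mul_one]
    exact h.symm
  | succ k ih =>
    have hp : ∫ x in (0 : ℝ)..1, ((-1 : ℝ) ^ k) * x ^ k = (-1) ^ k / ((k : ℝ) + 1) := by
      rw [intervalIntegral.integral_const_mul, integral_pow]
      simp [div_eq_mul_inv]
    have hs : ∫ x in (0 : ℝ)..1, (-1 : ℝ) ^ k * x ^ k / (1 + t * x) =
        ∫ x in (0 : ℝ)..1, ((-1 : ℝ) ^ k * x ^ k +
          t * ((-1) ^ (k + 1) * x ^ (k + 1) / (1 + t * x))) := by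
      refine intervalIntegral.integral_congr fun x hx => ?_
      have := (hpos x hx).ne'
      field_simp
      ring
    rw [intervalIntegral.integral_add ((by fun_prop : Continuous
      fun x : ℝ => (-1 : ℝ) ^ k * x ^ k).intervalIntegrable _ _)
      ((hcont (k + 1)).const_mul t), hp, intervalIntegral.integral_const_mul] at hs
    rw [Finset.sum_range_succ, ← sub_sub, ih, hs]
    ring

/-- The real value of the denominator of the approximant. -/
lemma eval_padeDen (n : ℕ) (t : ℝ) :
    ((padeDen n).map (algebraMap ℚ ℝ)).eval t =
      ∑ k ∈ Finset.range (n + 1), (n.choose k : ℝ) * ((n + k).choose k : ℝ) * t ^ (n - k) := by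
  simp [padeDen, Polynomial.eval_finsetSum, Polynomial.map_sum]

lemma eval_padeNum (n : ℕ) (t : ℝ) :
    ((padeNum n).map (algebraMap ℚ ℝ)).eval t =
      ∑ k ∈ Finset.range (n + 1), (n.choose k : ℝ) * ((n + k).choose k : ℝ) * t ^ (n - k) *
        ∑ i ∈ Finset.range k, (-1) ^ i * t ^ (i + 1) / ((i : ℝ) + 1) := by
  simp only [padeNum, Polynomial.map_sum, Polynomial.map_mul, Polynomial.map_C, Polynomial.map_X,
    Polynomial.map_pow, Polynomial.eval_mul, Polynomial.eval_finsetSum, Polynomial.eval_C,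
    Polynomial.eval_X, Polynomial.eval_pow]
  rw [Finset.mul_sum]
  refine Finset.sum_congr rfl fun k _ => ?_
  rw [Finset.mul_sum, Finset.mul_sum, Finset.mul_sum]
  refine Finset.sum_congr rfl fun i _ => ?_
  simp only [map_mul, map_div₀, map_pow, map_neg, map_one, map_natCast, map_add]
  ring

/-- The integral that measures the error of the approximant. -/
noncomputable def padeErrorIntegral (n : ℕ) (t : ℝ) : ℝ :=
  ∫ x in (0 : ℝ)..1, x ^ n * (1 - x) ^ n / (1 + t * x) ^ (n + 1)

/-- The linear form `D(t) ln (1 + t) - N(t)` is an integral transform of the Legendre polynomial,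
and orthogonality makes it small. -/
lemma padeDen_mul_log_sub_padeNum (n : ℕ) {t : ℝ} (ht : -1 < t) :
    ((padeDen n).map (algebraMap ℚ ℝ)).eval t * Real.log (1 + t) -
      ((padeNum n).map (algebraMap ℚ ℝ)).eval t = t ^ (2 * n + 1) * padeErrorIntegral n t := by
  have h : t ^ (n + 1) * ∫ x in (0 : ℝ)..1, legendreSum n x / (1 + t * x) =
      t ^ (2 * n + 1) * padeErrorIntegral n t := by
    rw [integral_legendreSum_div n ht, padeErrorIntegral]
    ring
  rw [← h, eval_padeDen, eval_padeNum, Finset.sum_mul, ← Finset.sum_sub_distrib]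
  have hs : ∀ x : ℝ, legendreSum n x / (1 + t * x) = ∑ k ∈ Finset.range (n + 1),
      (n.choose k : ℝ) * ((n + k).choose k : ℝ) * ((-1) ^ k * x ^ k / (1 + t * x)) := fun x => by
    rw [legendreSum, Finset.sum_div]
    exact Finset.sum_congr rfl fun k _ => by ring
  simp only [hs]
  rw [intervalIntegral.integral_finsetSum, Finset.mul_sum]
  · refine Finset.sum_congr rfl fun k hk => ?_
    rw [intervalIntegral.integral_const_mul, ← mul_sub, log_sub_taylor_eq_integral ht k]
    have : n + 1 = (n - k) + (k + 1) := by
      have := Finset.mem_range.mp hk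
      omega
    rw [this, pow_add]
    ring
  · intro k _
    refine IntervalIntegrable.const_mul ?_ _
    apply ContinuousOn.intervalIntegrable
    exact ContinuousOn.div (by fun_prop) (by fun_prop) fun x hx =>
      (one_add_mul_pos ht (by rwa [Set.uIcc_of_le zero_le_one] at hx)).ne'

lemma eval_zero_padeDen (n : ℕ) :
    ((padeDen n).map (algebraMap ℚ ℝ)).eval 0 = ((n + n).choose n : ℝ) := by
  rw [eval_padeDen, Finset.sum_eq_single n]
  · simp
  · intro k hk hne
    have : n - k ≠ 0 := by
      have := Finset.mem_range.mp hk
      omega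
    simp [this]
  · simp

lemma natDegree_padeDen_le (n : ℕ) : (padeDen n).natDegree ≤ n := by
  refine Polynomial.natDegree_sum_le_of_forall_le _ _ fun k _ => ?_
  exact (Polynomial.natDegree_C_mul_X_pow_le _ _).trans (Nat.sub_le _ _)

lemma natDegree_padeNum_le (n : ℕ) : (padeNum n).natDegree ≤ n := by
  rw [padeNum, Finset.mul_sum]
  refine Polynomial.natDegree_sum_le_of_forall_le _ _ fun k hk => ?_
  rw [mul_left_comm, Finset.mul_sum]
  refine (Polynomial.natDegree_C_mul_le _ _).trans ?_
  refine Polynomial.natDegree_sum_le_of_forall_le _ _ fun i hi => ?_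
  rw [mul_left_comm, ← pow_succ']
  refine (Polynomial.natDegree_C_mul_X_pow_le _ _).trans ?_
  have := Finset.mem_range.mp hk
  have := Finset.mem_range.mp hi
  omega

lemma padeErrorIntegral_nonneg (n : ℕ) {t : ℝ} (ht : -1 < t) : 0 ≤ padeErrorIntegral n t := by
  refine intervalIntegral.integral_nonneg zero_le_one fun x hx => ?_
  have := one_add_mul_pos ht hx
  have := hx.1
  have := sub_nonneg.mpr hx.2
  positivity

theorem isPadeApproximant_log (n : ℕ) :
    IsPadeApproximant (fun t : ℝ => Real.log (1 + t)) n n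
      ((padeNum n).map (algebraMap ℚ ℝ)) ((padeDen n).map (algebraMap ℚ ℝ)) := by
  have hD0 : ((padeDen n).map (algebraMap ℚ ℝ)).eval 0 ≠ 0 := by
    rw [eval_zero_padeDen]
    exact_mod_cast (Nat.choose_pos (by omega)).ne'
  refine ⟨Polynomial.natDegree_map_le.trans (natDegree_padeNum_le n),
    Polynomial.natDegree_map_le.trans (natDegree_padeDen_le n), hD0, ?_⟩
  have hcont : ContinuousAt (fun t : ℝ => (((padeDen n).map (algebraMap ℚ ℝ)).eval t)⁻¹) 0 :=
    (Polynomial.continuous _).continuousAt.inv₀ hD0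
  have hinv := hcont.isBigO_one ℝ
  -- Near the origin `1 + t x ≥ 1 / 2`, so the error integral is bounded there.
  have hI : (fun t : ℝ => padeErrorIntegral n t) =O[𝓝 0] (fun _ => (1 : ℝ)) := by
    refine Asymptotics.IsBigO.of_bound (2 ^ (n + 1)) ?_
    filter_upwards [Ioo_mem_nhds (show (-1 / 2 : ℝ) < 0 by norm_num)
      (show (0 : ℝ) < 1 by norm_num)] with t ht
    have := intervalIntegral.norm_integral_le_of_norm_le_const (a := 0) (b := 1)
      (f := fun x : ℝ => x ^ n * (1 - x) ^ n / (1 + t * x) ^ (n + 1)) (C := 2 ^ (n + 1))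
      (fun x hx => by
        rw [Set.uIoc_of_le zero_le_one] at hx
        have h1 : (1 / 2 : ℝ) ≤ 1 + t * x := by nlinarith [ht.1, hx.1, hx.2]
        have h2 : 0 ≤ 1 - x := by linarith [hx.2]
        have h0 := hx.1.le
        rw [Real.norm_of_nonneg (by positivity), div_le_iff₀ (by positivity), ← mul_pow (2 : ℝ)]
        calc x ^ n * (1 - x) ^ n ≤ 1 * 1 := by
              gcongr
              · exact pow_le_one₀ h0 hx.2
              · exact pow_le_one₀ h2 (by linarith)
          _ ≤ _ := by
            rw [mul_one]
            exact one_le_pow₀ (by linarith))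
    simpa [padeErrorIntegral] using this
  have h := ((Asymptotics.isBigO_refl (fun t : ℝ => t ^ (2 * n + 1)) (𝓝 0)).mul hI).mul hinv
  simp only [mul_one, ← two_mul] at h ⊢
  refine h.congr' ?_ EventuallyEq.rfl
  filter_upwards [(Polynomial.continuous
    ((padeDen n).map (algebraMap ℚ ℝ))).continuousAt.eventually_ne hD0,
    Ioi_mem_nhds (show (-1 : ℝ) < 0 by norm_num)] with t hD ht
  rw [← padeDen_mul_log_sub_padeNum n ht]
  field_simp

/-! ### Errors of the approximant and of the linear form -/

/-- The error `ln (1 + t) - [n/n]_t` of the Padé approximant. -/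
noncomputable def padeError (n : ℕ) (t : ℝ) : ℝ :=
  Real.log (1 + t) - ((padeNum n).map (algebraMap ℚ ℝ)).eval t /
    ((padeDen n).map (algebraMap ℚ ℝ)).eval t

lemma cast_padeLog (n : ℕ) (t : ℚ) :
    ((padeLog n t : ℚ) : ℝ) = Real.log (1 + t) - padeError n t := by
  have h : ∀ P : ℚ[X], (P.map (algebraMap ℚ ℝ)).eval (t : ℝ) = ((P.eval t : ℚ) : ℝ) := fun P =>
    Polynomial.eval_map_apply (f := algebraMap ℚ ℝ) (p := P) t
  simp only [padeLog, padeError, h]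
  push_cast
  ring

/-- The sum of the coefficients `C(n,k) C(n+k,k)`, which is also the value at `1` of the
denominator of the approximant. -/
noncomputable def coeffSum (n : ℕ) : ℝ :=
  ∑ k ∈ Finset.range (n + 1), (n.choose k : ℝ) * ((n + k).choose k : ℝ)

lemma padeDen_pos (n : ℕ) {t : ℝ} (ht : 0 ≤ t) :
    0 < ((padeDen n).map (algebraMap ℚ ℝ)).eval t := by
  rw [eval_padeDen]
  refine Finset.sum_pos' (fun k _ => by positivity) ⟨n, by simp, ?_⟩
  have : 0 < (n + n).choose n := Nat.choose_pos (by omega)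
  simp [this]

lemma pow_mul_coeffSum_le (n : ℕ) {t T : ℝ} (ht : 0 ≤ t) (htT : t ≤ T) (hT : 1 ≤ T) :
    t ^ n * coeffSum n ≤ T ^ n * ((padeDen n).map (algebraMap ℚ ℝ)).eval t := by
  rw [eval_padeDen, coeffSum, Finset.mul_sum, Finset.mul_sum]
  refine Finset.sum_le_sum fun k hk => ?_
  have hkn : k ≤ n := by
    have := Finset.mem_range.mp hk
    omega
  have : t ^ n ≤ T ^ n * t ^ (n - k) := by
    calc t ^ n = t ^ k * t ^ (n - k) := by rw [← pow_add]; congr 1; omega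
      _ ≤ T ^ n * t ^ (n - k) := by
        gcongr
        exact (pow_le_pow_left₀ ht htT k).trans (pow_le_pow_right₀ hT hkn)
  calc _ ≤ (T ^ n * t ^ (n - k)) * ((n.choose k : ℝ) * ((n + k).choose k : ℝ)) := by gcongr
    _ = _ := by ring

/-- The maximum of `t x (1 - x) / (1 + t x)` over `x` is at most `9 / 50` for `t` slightly beyond
`1`; at `t = 1` it equals `3 - 2 √2`. -/
lemma pow_mul_padeErrorIntegral_le (n : ℕ) {t : ℝ} (ht : 0 ≤ t) (ht' : t ≤ 21 / 20) :
    t ^ (n + 1) * padeErrorIntegral n t ≤ (9 / 50) ^ n * Real.log (1 + t) := by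
  have hlog := log_sub_taylor_eq_integral (show -1 < t by linarith) 0
  simp only [Finset.range_zero, Finset.sum_empty, sub_zero, zero_add, pow_one, pow_zero,
    mul_one] at hlog
  have hpos : ∀ x ∈ Set.Icc (0 : ℝ) 1, 0 < 1 + t * x := fun x hx =>
    one_add_mul_pos (by linarith) hx
  rw [hlog, padeErrorIntegral, ← intervalIntegral.integral_const_mul,
    ← intervalIntegral.integral_const_mul, ← intervalIntegral.integral_const_mul]
  have hne : ∀ x ∈ Set.uIcc (0 : ℝ) 1, (1 + t * x) ≠ 0 := fun x hx =>
    (hpos x (by rwa [Set.uIcc_of_le zero_le_one] at hx)).ne'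
  refine intervalIntegral.integral_mono_on zero_le_one ?_ ?_ fun x hx => ?_
  · apply ContinuousOn.intervalIntegrable
    exact continuousOn_const.mul <| ContinuousOn.div (by fun_prop) (by fun_prop)
      fun x hx => pow_ne_zero _ (hne x hx)
  · apply ContinuousOn.intervalIntegrable
    exact continuousOn_const.mul <| continuousOn_const.mul <|
      ContinuousOn.div (by fun_prop) (by fun_prop) hne
  · have h := hpos x hx
    have h0 := hx.1
    have h1 := sub_nonneg.mpr hx.2
    have hle : t * x * (1 - x) / (1 + t * x) ≤ 9 / 50 := by
      rw [div_le_iff₀ h]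
      -- The claim is `t (41/50 x - x^2) ≤ 9/50`, and the bracket is at most `(41/100)^2`.
      nlinarith [mul_nonneg ht (sq_nonneg (x - 41 / 100))]
    calc t ^ (n + 1) * (x ^ n * (1 - x) ^ n / (1 + t * x) ^ (n + 1))
        = (t * x * (1 - x) / (1 + t * x)) ^ n * (t * (1 / (1 + t * x))) := by
          rw [div_pow, mul_pow, mul_pow]
          field_simp
          ring
      _ ≤ (9 / 50) ^ n * (t * (1 / (1 + t * x))) := by gcongr

lemma padeError_mul_padeDen (n : ℕ) {t : ℝ} (ht : 0 ≤ t) :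
    padeError n t * ((padeDen n).map (algebraMap ℚ ℝ)).eval t =
      t ^ (2 * n + 1) * padeErrorIntegral n t := by
  rw [← padeDen_mul_log_sub_padeNum n (by linarith), padeError]
  have := (padeDen_pos n ht).ne'
  field_simp

lemma padeError_nonneg (n : ℕ) {t : ℝ} (ht : 0 ≤ t) : 0 ≤ padeError n t := by
  have h := padeError_mul_padeDen n ht
  have hI := padeErrorIntegral_nonneg n (show -1 < t by linarith)
  refine nonneg_of_mul_nonneg_left (b := ((padeDen n).map (algebraMap ℚ ℝ)).eval t) ?_
    (padeDen_pos n ht)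
  rw [h]
  positivity

lemma padeError_zero (n : ℕ) : padeError n 0 = 0 := by
  have h := padeError_mul_padeDen n le_rfl
  rw [zero_pow (by omega), zero_mul] at h
  exact (mul_eq_zero.mp h).resolve_right (padeDen_pos n le_rfl).ne'

lemma coeffSum_mul_padeError_le (n : ℕ) {t T : ℝ} (ht : 0 ≤ t) (htT : t ≤ T) (hT : 1 ≤ T)
    (hT' : T ≤ 21 / 20) :
    coeffSum n * padeError n t ≤ Real.log (1 + T) * (9 / 50 * T) ^ n := by
  have hlogT : 0 ≤ Real.log (1 + T) := Real.log_nonneg (by linarith)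
  rcases ht.eq_or_lt with rfl | hpos
  · rw [padeError_zero, mul_zero]
    positivity
  refine le_of_mul_le_mul_left ?_ (pow_pos hpos n)
  calc t ^ n * (coeffSum n * padeError n t) = (t ^ n * coeffSum n) * padeError n t := by ring
    _ ≤ (T ^ n * ((padeDen n).map (algebraMap ℚ ℝ)).eval t) * padeError n t :=
        mul_le_mul_of_nonneg_right (pow_mul_coeffSum_le n ht htT hT) (padeError_nonneg n ht)
    _ = T ^ n * t ^ n * (t ^ (n + 1) * padeErrorIntegral n t) := by
        rw [mul_assoc, mul_comm _ (padeError n t), padeError_mul_padeDen n ht]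
        ring
    _ ≤ T ^ n * t ^ n * ((9 / 50) ^ n * Real.log (1 + t)) :=
        mul_le_mul_of_nonneg_left (pow_mul_padeErrorIntegral_le n ht (htT.trans hT'))
          (by positivity)
    _ ≤ T ^ n * t ^ n * ((9 / 50) ^ n * Real.log (1 + T)) := by gcongr
    _ = _ := by rw [mul_pow]; ring

lemma two_mul_le_two_pow (p : ℕ) : 2 * p ≤ 2 ^ p := by
  induction p with
  | zero => simp
  | succ p ih =>
    rcases Nat.eq_zero_or_pos p with rfl | hp
    · simp
    · rw [pow_succ]; omega

lemma mul_succ_le_coeffSum (n : ℕ) (hn : 1 ≤ n) : (n : ℝ) * (n + 1) ≤ coeffSum n := by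
  have := Finset.single_le_sum (f := fun k => (n.choose k : ℝ) * ((n + k).choose k : ℝ))
    (fun k _ => by positivity) (show 1 ∈ Finset.range (n + 1) by simp; omega)
  simpa [coeffSum] using this

/-- Replacing the logarithms by Padé approximants costs one error term per logarithm; the signed
coefficients add up to `1`, so `ln 2` enters `p` times. -/
lemma logForm_sub_ratForm (n m p : ℕ) (h : n + 1 = 2 ^ p + m) :
    logForm n m - (ratForm n m p : ℝ) = p * padeError n 1 +
      ∑ k ∈ Finset.range (n + 1), (n.choose k : ℝ) * ((n + k).choose k : ℝ) * (-1) ^ (n + k) *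
        padeError n (k / 2 ^ p) := by
  have h2 : (0 : ℝ) < 2 ^ p := by positivity
  have hR : (n : ℝ) + 1 = 2 ^ p + m := by exact_mod_cast h
  have hlog : ∀ k : ℕ, Real.log ((n : ℝ) - m + k + 1) =
      p * Real.log 2 + Real.log (1 + k / 2 ^ p) := fun k => by
    rw [← Real.log_pow, ← Real.log_mul h2.ne' (by positivity)]
    congr 1
    field_simp
    linarith
  have hrat : (ratForm n m p : ℝ) = p * (Real.log 2 - padeError n 1) +
      ∑ k ∈ Finset.range (n + 1), (n.choose k : ℝ) * ((n + k).choose k : ℝ) * (-1) ^ (n + k) *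
        (Real.log (1 + k / 2 ^ p) - padeError n (k / 2 ^ p)) := by
    have e : (n : ℚ) - m + 1 = 2 ^ p := by
      have : (n : ℚ) + 1 = 2 ^ p + m := by exact_mod_cast h
      linarith
    simp only [ratForm, e]
    push_cast
    simp only [cast_padeLog]
    push_cast
    norm_num
  have hs := sum_signed_coeff_eq_one n
  rw [hrat, logForm]
  simp only [hlog, mul_add, mul_sub, Finset.sum_add_distrib, Finset.sum_sub_distrib]
  rw [← Finset.sum_mul, hs]
  ring

lemma abs_logForm_sub_ratForm_le (n m p : ℕ) (hn : 1 ≤ n) (h : n + 1 = 2 ^ p + m) {T : ℝ}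
    (hT : 1 ≤ T) (hT' : T ≤ 21 / 20) (hnT : (n : ℝ) ≤ T * 2 ^ p) :
    |logForm n m - (ratForm n m p : ℝ)| ≤
      (1 + 1 / (2 * n)) * (Real.log (1 + T) * (9 / 50 * T) ^ n) := by
  set B := Real.log (1 + T) * (9 / 50 * T) ^ n with hB
  have hn' : (1 : ℝ) ≤ n := by exact_mod_cast hn
  have hQ := mul_succ_le_coeffSum n hn
  have hQpos : 0 < coeffSum n := lt_of_lt_of_le (by positivity) hQ
  have hBnn : 0 ≤ B := mul_nonneg (Real.log_nonneg (by linarith)) (by positivity)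
  have hE : ∀ t : ℝ, 0 ≤ t → t ≤ T → |padeError n t| ≤ B / coeffSum n := fun t ht htT => by
    rw [abs_of_nonneg (padeError_nonneg n ht), le_div_iff₀ hQpos, mul_comm]
    exact coeffSum_mul_padeError_le n ht htT hT hT'
  have hp : (p : ℝ) / coeffSum n ≤ 1 / (2 * n) := by
    have : 2 * p ≤ n + 1 := (two_mul_le_two_pow p).trans (by omega)
    have : 2 * (p : ℝ) ≤ n + 1 := by exact_mod_cast this
    rw [div_le_div_iff₀ hQpos (by positivity)]
    nlinarith
  rw [logForm_sub_ratForm n m p h]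
  calc _ ≤ |(p : ℝ) * padeError n 1| + |∑ k ∈ Finset.range (n + 1), (n.choose k : ℝ) *
        ((n + k).choose k : ℝ) * (-1) ^ (n + k) * padeError n (k / 2 ^ p)| := abs_add_le _ _
    _ ≤ p * (B / coeffSum n) + ∑ k ∈ Finset.range (n + 1), (n.choose k : ℝ) *
        ((n + k).choose k : ℝ) * (B / coeffSum n) := by
      refine add_le_add ?_ ((Finset.abs_sum_le_sum_abs _ _).trans
        (Finset.sum_le_sum fun k hk => ?_))
      · rw [abs_mul, Nat.abs_cast]
        exact mul_le_mul_of_nonneg_left (hE 1 zero_le_one hT) (by positivity)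
      · rw [abs_mul, abs_mul, abs_pow, abs_neg, abs_one, one_pow, mul_one,
          abs_of_nonneg (by positivity : (0 : ℝ) ≤ (n.choose k : ℝ) * ((n + k).choose k : ℝ))]
        refine mul_le_mul_of_nonneg_left (hE _ (by positivity) ?_) (by positivity)
        rw [div_le_iff₀ (by positivity)]
        have : (k : ℝ) ≤ n := by
          have := Finset.mem_range.mp hk
          exact_mod_cast (by omega : k ≤ n)
        linarith
    _ = (1 + p / coeffSum n) * B := by
      rw [← Finset.sum_mul, ← coeffSum]
      field_simp
      ring
    _ ≤ _ := by gcongr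

lemma mul_pow_eighteen_div_le (n : ℕ) (hn : 1 ≤ n) :
    ((n : ℝ) + 1 / 2) * (7 / 10) * (18 / 25) ^ n ≤ 1 := by
  rcases (by omega : n = 1 ∨ n = 2 ∨ 3 ≤ n) with rfl | rfl | h3
  · norm_num
  · norm_num
  · induction n, h3 using Nat.le_induction with
    | base => norm_num
    | succ k hk ih =>
      refine le_trans ?_ (ih (by omega))
      have : (3 : ℝ) ≤ k := by exact_mod_cast hk
      have hp : (0 : ℝ) < (18 / 25) ^ k := by positivity
      rw [pow_succ]
      push_cast
      nlinarith

theorem abs_logForm_sub_ratForm_le_of_le_one (m p n : ℕ) (hm : m ≤ 1) (hn : 1 ≤ n)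
    (h : n + 1 = 2 ^ p + m) :
    |logForm n m - (ratForm n m p : ℝ)| ≤ ((4 : ℝ) ^ n)⁻¹ / (n : ℝ) := by
  have hle : (n : ℝ) ≤ 1 * 2 ^ p := by
    rw [one_mul]
    exact_mod_cast (by omega : n ≤ 2 ^ p)
  refine (abs_logForm_sub_ratForm_le n m p hn h le_rfl (by norm_num) hle).trans ?_
  have hn' : (1 : ℝ) ≤ n := by exact_mod_cast hn
  have hlog : Real.log (1 + 1) ≤ 7 / 10 := by
    have := Real.log_two_lt_d9
    norm_num at this ⊢
    linarith
  rw [le_div_iff₀ (by positivity), ← one_div, le_div_iff₀ (by positivity)]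
  calc (1 + 1 / (2 * (n : ℝ))) * (Real.log (1 + 1) * (9 / 50 * 1) ^ n) * n * 4 ^ n
      = (n + 1 / 2) * Real.log (1 + 1) * (18 / 25) ^ n := by
        rw [show (18 / 25 : ℝ) = 9 / 50 * 1 * 4 by norm_num, mul_pow _ (4 : ℝ)]
        field_simp
    _ ≤ (n + 1 / 2) * (7 / 10) * (18 / 25) ^ n := by gcongr
    _ ≤ 1 := mul_pow_eighteen_div_le n hn

/-- For fixed `m` the nodes `k / 2^p` eventually stay below `21 / 20`, and the error is then
exponentially smaller than `4^(-n)`. -/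
lemma eventually_abs_logForm_sub_ratForm_le (m : ℕ) : ∀ᶠ p : ℕ in atTop, ∀ n : ℕ,
    n + 1 = 2 ^ p + m → |logForm n m - (ratForm n m p : ℝ)| ≤ 2 * (189 / 1000) ^ n := by
  have hev : ∀ᶠ p : ℕ in atTop, 20 * m + 2 ≤ 2 ^ p :=
    (tendsto_pow_atTop_atTop_of_one_lt (by norm_num : (1 : ℕ) < 2)).eventually_ge_atTop _
  filter_upwards [hev] with p hp n hn
  have hn1 : 1 ≤ n := by omega
  have hle : (n : ℝ) ≤ 21 / 20 * 2 ^ p := by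
    have : 20 * n ≤ 21 * 2 ^ p := by omega
    have : (20 : ℝ) * n ≤ 21 * 2 ^ p := by exact_mod_cast this
    linarith
  refine (abs_logForm_sub_ratForm_le n m p hn1 hn (by norm_num) le_rfl hle).trans ?_
  have hn' : (1 : ℝ) ≤ n := by exact_mod_cast hn1
  have h1 : 1 / (2 * (n : ℝ)) ≤ 1 / 2 := by
    rw [div_le_div_iff₀ (by positivity) (by norm_num)]
    linarith
  have hlog : Real.log (1 + 21 / 20) ≤ 21 / 20 := by
    have := Real.log_le_sub_one_of_pos (show (0 : ℝ) < 1 + 21 / 20 by norm_num)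
    linarith
  have e : (9 / 50 * (21 / 20) : ℝ) = 189 / 1000 := by norm_num
  rw [e]
  calc _ ≤ (1 + 1 / 2) * (21 / 20 * (189 / 1000 : ℝ) ^ n) := by gcongr
    _ ≤ _ := by nlinarith [pow_pos (show (0 : ℝ) < 189 / 1000 by norm_num) n]

lemma tendsto_two_pow_add_sub_one (m : ℕ) :
    Tendsto (fun p : ℕ => 2 ^ p + m - 1) atTop atTop := by
  refine tendsto_atTop_mono (fun p => ?_) tendsto_id
  have := Nat.lt_two_pow_self (n := p)
  simp only [id]
  omega

theorem eventually_abs_logForm_sub_ratForm_le_inv (m : ℕ) : ∀ᶠ p : ℕ in atTop, ∀ n : ℕ,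
    n + 1 = 2 ^ p + m → |logForm n m - (ratForm n m p : ℝ)| ≤ ((4 : ℝ) ^ n)⁻¹ / (n : ℝ) := by
  have ht : Tendsto (fun n : ℕ => (n : ℝ) * (189 / 250) ^ n) atTop (𝓝 0) :=
    tendsto_self_mul_const_pow_of_lt_one (by norm_num) (by norm_num)
  have hev : ∀ᶠ n : ℕ in atTop, 1 ≤ n ∧ (n : ℝ) * (189 / 250) ^ n ≤ 1 / 2 :=
    (eventually_ge_atTop 1).and (ht.eventually_le_const (by norm_num))
  filter_upwards [eventually_abs_logForm_sub_ratForm_le m,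
    (tendsto_two_pow_add_sub_one m).eventually hev] with p hp hq n hn
  obtain ⟨hn1, hq⟩ : 1 ≤ n ∧ (n : ℝ) * (189 / 250) ^ n ≤ 1 / 2 := by
    rwa [← hn, Nat.add_sub_cancel] at hq
  refine (hp n hn).trans ?_
  have hn' : (0 : ℝ) < n := by exact_mod_cast hn1
  rw [le_div_iff₀ hn', ← one_div, le_div_iff₀ (by positivity)]
  calc 2 * (189 / 1000 : ℝ) ^ n * n * 4 ^ n = 2 * (n * (189 / 250) ^ n) := by
        rw [show (189 / 250 : ℝ) = 189 / 1000 * 4 by norm_num, mul_pow _ (4 : ℝ)]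
        ring
    _ ≤ 1 := by linarith

/-! ### A double integral for Euler's constant -/

/-- Lebesgue measure on the unit interval. -/
noncomputable def unitVolume : Measure ℝ := volume.restrict (Set.Ioc 0 1)

instance isFiniteMeasure_unitVolume : IsFiniteMeasure unitVolume := by
  unfold unitVolume
  infer_instance

/-- The kernel `(1 - x^y) / (1 - x)`, whose mean over `y` is the kernel
`1 / (1 - x) + 1 / ln x` of Euler's constant. -/
noncomputable def eulerKernel (y x : ℝ) : ℝ := (1 - x ^ y) / (1 - x)

lemma measurable_eulerKernel : Measurable (fun z : ℝ × ℝ => eulerKernel z.1 z.2) := by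
  unfold eulerKernel
  fun_prop

lemma eulerKernel_mem_Icc {y x : ℝ} (hy : y ∈ Set.Ioc (0 : ℝ) 1) (hx : x ∈ Set.Ioc (0 : ℝ) 1) :
    eulerKernel y x ∈ Set.Icc (0 : ℝ) 1 := by
  unfold eulerKernel
  rcases hx.2.eq_or_lt with rfl | hx1
  · simp
  have h1 : x ^ y ≤ 1 := Real.rpow_le_one hx.1.le hx.2 hy.1.le
  have h2 : x ≤ x ^ y := by
    simpa using Real.rpow_le_rpow_of_exponent_ge hx.1 hx.2 hy.2
  have h3 : 0 < 1 - x := by linarith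
  exact ⟨div_nonneg (by linarith) h3.le, (div_le_one h3).mpr (by linarith)⟩

lemma ae_unitVolume_prod_mem : ∀ᵐ z ∂(unitVolume.prod unitVolume),
    z.1 ∈ Set.Ioc (0 : ℝ) 1 ∧ z.2 ∈ Set.Ioc (0 : ℝ) 1 := by
  rw [unitVolume, Measure.prod_restrict]
  exact ae_restrict_mem (measurableSet_Ioc.prod measurableSet_Ioc)

lemma integrable_continuous_mul_eulerKernel {f : ℝ → ℝ} (hf : Continuous f) :
    Integrable (fun z : ℝ × ℝ => f z.2 * eulerKernel z.1 z.2) (unitVolume.prod unitVolume) := by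
  obtain ⟨C, hC⟩ := (isCompact_Icc (a := (0 : ℝ)) (b := 1)).exists_bound_of_continuousOn
    hf.continuousOn
  refine Integrable.of_bound
    ((hf.measurable.comp measurable_snd).mul measurable_eulerKernel).aestronglyMeasurable C ?_
  filter_upwards [ae_unitVolume_prod_mem] with z hz
  have hk := eulerKernel_mem_Icc hz.1 hz.2
  have hb := hC z.2 ⟨hz.2.1.le, hz.2.2⟩
  rw [norm_mul, Real.norm_of_nonneg hk.1]
  exact (mul_le_of_le_one_right (norm_nonneg _) hk.2).trans hb

/-- The moments of the kernel of Euler's constant. -/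
noncomputable def eulerMoment (M : ℕ) : ℝ :=
  ∫ z, z.2 ^ M * eulerKernel z.1 z.2 ∂(unitVolume.prod unitVolume)

lemma integral_unitVolume (f : ℝ → ℝ) : ∫ x, f x ∂unitVolume = ∫ x in (0 : ℝ)..1, f x :=
  (intervalIntegral.integral_of_le zero_le_one).symm

lemma integral_pow_mul_one_sub_rpow (M : ℕ) {y : ℝ} (hy : 0 < y) :
    ∫ x in (0 : ℝ)..1, x ^ M * (1 - x ^ y) = 1 / ((M : ℝ) + 1) - 1 / ((M : ℝ) + 1 + y) := by
  have h1 : ∫ x in (0 : ℝ)..1, x ^ M * (1 - x ^ y) =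
      ∫ x in (0 : ℝ)..1, (x ^ M - x ^ ((M : ℝ) + y)) := by
    refine intervalIntegral.integral_congr fun x hx => ?_
    rw [Set.uIcc_of_le zero_le_one] at hx
    rw [Real.rpow_add_of_nonneg hx.1 (by positivity) hy.le, Real.rpow_natCast]
    ring
  have hM : (0 : ℝ) ≤ M := Nat.cast_nonneg M
  rw [h1, intervalIntegral.integral_sub (by simp) (intervalIntegral.intervalIntegrable_rpow'
    (by linarith)), integral_pow, integral_rpow (Or.inl (by linarith))]
  have : (M : ℝ) + y + 1 ≠ 0 := by positivity
  rw [Real.zero_rpow this]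
  simp
  ring

lemma integral_one_div_add (M : ℕ) :
    ∫ y in (0 : ℝ)..1, 1 / ((M : ℝ) + 1 + y) =
      Real.log ((M : ℝ) + 2) - Real.log ((M : ℝ) + 1) := by
  have hpos : ∀ y ∈ Set.uIcc (0 : ℝ) 1, (M : ℝ) + 1 + y ≠ 0 := fun y hy => by
    rw [Set.uIcc_of_le zero_le_one] at hy
    have := hy.1
    positivity
  rw [intervalIntegral.integral_eq_sub_of_hasDerivAt
    (f := fun y : ℝ => Real.log ((M : ℝ) + 1 + y))]
  · norm_num [add_assoc]
  · intro y hy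
    exact ((hasDerivAt_id y).const_add ((M : ℝ) + 1)).log (hpos y hy)
  · apply ContinuousOn.intervalIntegrable
    exact ContinuousOn.div (by fun_prop) (by fun_prop) hpos

lemma eulerMoment_sub_succ (M : ℕ) : eulerMoment M - eulerMoment (M + 1) =
    1 / ((M : ℝ) + 1) - (Real.log ((M : ℝ) + 2) - Real.log ((M : ℝ) + 1)) := by
  have hi := fun k : ℕ => integrable_continuous_mul_eulerKernel (continuous_pow (M := ℝ) k)
  have h1 : eulerMoment M - eulerMoment (M + 1) =
      ∫ z, z.2 ^ M * (1 - z.2 ^ z.1) ∂(unitVolume.prod unitVolume) := by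
    rw [eulerMoment, eulerMoment, ← integral_sub (hi M) (hi (M + 1))]
    refine integral_congr_ae ?_
    filter_upwards [ae_unitVolume_prod_mem] with z hz
    unfold eulerKernel
    rcases hz.2.2.eq_or_lt with h | h
    · simp [h]
    · have : 1 - z.2 ≠ 0 := by linarith
      field_simp
      ring
  have hint : Integrable (fun z : ℝ × ℝ => z.2 ^ M * (1 - z.2 ^ z.1))
      (unitVolume.prod unitVolume) := by
    refine Integrable.of_bound (by fun_prop) 1 ?_
    filter_upwards [ae_unitVolume_prod_mem] with z hz
    have h1 : z.2 ^ z.1 ≤ 1 := Real.rpow_le_one hz.2.1.le hz.2.2 hz.1.1.le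
    have h2 : 0 ≤ z.2 ^ z.1 := Real.rpow_nonneg hz.2.1.le _
    have h3 : z.2 ^ M ≤ 1 := pow_le_one₀ hz.2.1.le hz.2.2
    have h4 : 0 ≤ z.2 ^ M := pow_nonneg hz.2.1.le M
    rw [Real.norm_of_nonneg (mul_nonneg h4 (by linarith))]
    nlinarith
  rw [h1, integral_prod _ hint]
  simp only [integral_unitVolume]
  have h2 : ∫ y in (0 : ℝ)..1, ∫ x in (0 : ℝ)..1, x ^ M * (1 - x ^ y) =
      ∫ y in (0 : ℝ)..1, (1 / ((M : ℝ) + 1) - 1 / ((M : ℝ) + 1 + y)) := by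
    refine intervalIntegral.integral_congr_ae (Eventually.of_forall fun y hy => ?_)
    rw [Set.uIoc_of_le zero_le_one] at hy
    exact integral_pow_mul_one_sub_rpow M hy.1
  rw [h2, intervalIntegral.integral_sub (by simp), integral_one_div_add]
  · simp
  · apply ContinuousOn.intervalIntegrable
    refine ContinuousOn.div (by fun_prop) (by fun_prop) fun y hy => ?_
    rw [Set.uIcc_of_le zero_le_one] at hy
    have := hy.1
    positivity

lemma tendsto_eulerMoment : Tendsto eulerMoment atTop (𝓝 0) := by
  refine squeeze_zero (fun M => ?_) (fun M => ?_) tendsto_one_div_add_atTop_nhds_zero_nat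
  · refine integral_nonneg_of_ae ?_
    filter_upwards [ae_unitVolume_prod_mem] with z hz
    exact mul_nonneg (pow_nonneg hz.2.1.le M) (eulerKernel_mem_Icc hz.1 hz.2).1
  · have hint : Integrable (fun z : ℝ × ℝ => z.2 ^ M) (unitVolume.prod unitVolume) := by
      refine Integrable.of_bound (by fun_prop) 1 ?_
      filter_upwards [ae_unitVolume_prod_mem] with z hz
      rw [Real.norm_of_nonneg (pow_nonneg hz.2.1.le M)]
      exact pow_le_one₀ hz.2.1.le hz.2.2
    calc eulerMoment M ≤ ∫ z : ℝ × ℝ, z.2 ^ M ∂(unitVolume.prod unitVolume) := by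
          refine integral_mono_ae
            (integrable_continuous_mul_eulerKernel (continuous_pow (M := ℝ) M)) hint ?_
          filter_upwards [ae_unitVolume_prod_mem] with z hz
          exact mul_le_of_le_one_right (pow_nonneg hz.2.1.le M) (eulerKernel_mem_Icc hz.1 hz.2).2
      _ = 1 / ((M : ℝ) + 1) := by
          rw [integral_prod _ hint]
          simp only [integral_unitVolume]
          simp

/-- Both sides have the same differences in `M` and tend to `0`. -/
lemma eulerMoment_eq (M : ℕ) :
    eulerMoment M = Real.eulerMascheroniConstant - harmonic M + Real.log ((M : ℝ) + 1) := by
  set W : ℕ → ℝ := fun M => eulerMoment M -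
    (Real.eulerMascheroniConstant - harmonic M + Real.log ((M : ℝ) + 1)) with hW
  have hstep : ∀ M, W (M + 1) = W M := fun M => by
    have h := eulerMoment_sub_succ M
    simp only [hW, harmonic_succ]
    push_cast
    rw [add_assoc (M : ℝ) 1 1, one_add_one_eq_two]
    rw [one_div] at h
    linarith
  have hconst : ∀ j, W j = W M := by
    have h0 : ∀ j, W j = W 0 := fun j => by
      induction j with
      | zero => rfl
      | succ j ih => rw [hstep, ih]
    exact fun j => (h0 j).trans (h0 M).symm
  have hlim : Tendsto W atTop (𝓝 (0 - (Real.eulerMascheroniConstant -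
      Real.eulerMascheroniConstant))) := by
    refine tendsto_eulerMoment.sub ?_
    have := Real.tendsto_harmonic_sub_log_add_one
    refine (tendsto_const_nhds.sub this).congr fun j => ?_
    ring
  have hlim' : Tendsto W atTop (𝓝 (W M)) :=
    tendsto_const_nhds.congr fun j => (hconst j).symm
  have := tendsto_nhds_unique hlim' hlim
  simp only [hW] at this
  linarith

/-- The rational number `∑_k (-1)^(n+k) C(n,k) C(n+k,k) H_k`, with `H_k` the harmonic numbers. -/
noncomputable def harmonicForm (n : ℕ) : ℝ :=
  ∑ k ∈ Finset.range (n + 1),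
    (n.choose k : ℝ) * ((n + k).choose k : ℝ) * (-1) ^ (n + k) * (harmonic k : ℝ)

lemma sum_signed_coeff_div_eq_zero (n N : ℕ) (h : N < n) :
    ∑ k ∈ Finset.range (n + 1), (n.choose k : ℝ) * ((n + k).choose k : ℝ) * (-1) ^ (n + k) *
      (1 / ((N : ℝ) + k + 1)) = 0 := by
  have h0 := integral_legendreSum_mul_pow n N h
  simp only [legendreSum, Finset.sum_mul] at h0
  rw [intervalIntegral.integral_finsetSum
    (fun k _ => Continuous.intervalIntegrable (by fun_prop) _ _)] at h0
  calc _ = (-1) ^ n * ∑ k ∈ Finset.range (n + 1), ∫ x in (0 : ℝ)..1,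
        (n.choose k : ℝ) * ((n + k).choose k : ℝ) * (-1) ^ k * x ^ k * x ^ N := by
        rw [Finset.mul_sum]
        refine Finset.sum_congr rfl fun k _ => ?_
        simp only [mul_assoc, ← pow_add]
        simp only [intervalIntegral.integral_const_mul, integral_pow]
        push_cast
        rw [one_pow, zero_pow (by omega), pow_add]
        ring
    _ = 0 := by rw [h0, mul_zero]

/-- Orthogonality of the Legendre polynomial to lower degrees lets the harmonic numbers
`H_{N+k}` be replaced by `H_k`. -/
lemma sum_signed_coeff_mul_harmonic_add (n N : ℕ) (h : N ≤ n) :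
    ∑ k ∈ Finset.range (n + 1), (n.choose k : ℝ) * ((n + k).choose k : ℝ) * (-1) ^ (n + k) *
      (harmonic (N + k) : ℝ) = harmonicForm n := by
  induction N with
  | zero => simp [harmonicForm]
  | succ N ih =>
    rw [← ih (by omega), ← sub_eq_zero, ← Finset.sum_sub_distrib,
      ← sum_signed_coeff_div_eq_zero n N (by omega)]
    refine Finset.sum_congr rfl fun k _ => ?_
    rw [show N + 1 + k = N + k + 1 by ring, harmonic_succ]
    push_cast
    ring

/-- The remainder in the approximation of Euler's constant by `harmonicForm n - logForm n m`. -/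
noncomputable def eulerRemainder (n m : ℕ) : ℝ :=
  (-1) ^ n * ∫ z, (z.2 ^ (n - m) * legendreSum n z.2) * eulerKernel z.1 z.2
    ∂(unitVolume.prod unitVolume)

lemma eulerRemainder_eq (n m : ℕ) (h : m ≤ n) :
    eulerRemainder n m = Real.eulerMascheroniConstant + logForm n m - harmonicForm n := by
  have h1 : eulerRemainder n m = ∑ k ∈ Finset.range (n + 1),
      (n.choose k : ℝ) * ((n + k).choose k : ℝ) * (-1) ^ (n + k) * eulerMoment (n - m + k) := by
    have e : ∀ z : ℝ × ℝ, (z.2 ^ (n - m) * legendreSum n z.2) * eulerKernel z.1 z.2 =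
        ∑ k ∈ Finset.range (n + 1), (n.choose k : ℝ) * ((n + k).choose k : ℝ) * (-1) ^ k *
          (z.2 ^ (n - m + k) * eulerKernel z.1 z.2) := fun z => by
      rw [legendreSum, Finset.mul_sum, Finset.sum_mul]
      refine Finset.sum_congr rfl fun k _ => ?_
      rw [pow_add]
      ring
    rw [eulerRemainder]
    simp only [e]
    rw [integral_finsetSum _ fun k _ => (integrable_continuous_mul_eulerKernel
      (continuous_pow (M := ℝ) (n - m + k))).const_mul _, Finset.mul_sum]
    refine Finset.sum_congr rfl fun k _ => ?_
    rw [integral_const_mul, eulerMoment, pow_add]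
    ring
  rw [h1, ← sum_signed_coeff_mul_harmonic_add n (n - m) (Nat.sub_le n m), logForm]
  have hγ : Real.eulerMascheroniConstant = ∑ k ∈ Finset.range (n + 1), (n.choose k : ℝ) *
      ((n + k).choose k : ℝ) * (-1) ^ (n + k) * Real.eulerMascheroniConstant := by
    rw [← Finset.sum_mul, sum_signed_coeff_eq_one, one_mul]
  rw [hγ, ← Finset.sum_add_distrib, ← Finset.sum_sub_distrib]
  refine Finset.sum_congr rfl fun k _ => ?_
  have e : ((n - m + k : ℕ) : ℝ) + 1 = n - m + k + 1 := by push_cast [Nat.cast_sub h]; ring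
  rw [eulerMoment_eq, e]
  ring

/-! ### Stieltjes representation and size of the remainder -/

/-- The constant in the Stieltjes representation of `x ↦ x^y`; it equals `sin (π y) / π`. -/
noncomputable def stieltjesConst (y : ℝ) : ℝ :=
  (∫ t in Set.Ioi (0 : ℝ), Real.rpowIntegrand₀₁ y t 1)⁻¹

lemma stieltjesConst_pos {y : ℝ} (hy : y ∈ Set.Ioo (0 : ℝ) 1) : 0 < stieltjesConst y :=
  inv_pos.mpr (Real.integral_rpowIntegrand₀₁_one_pos hy)

/-- The integrand of the Stieltjes representation of `eulerKernel y`. -/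
noncomputable def stieltjesIntegrand (y x s : ℝ) : ℝ := s ^ y / ((1 + s) * (x + s))

lemma stieltjesIntegrand_nonneg {x s : ℝ} (y : ℝ) (hx : 0 ≤ x) (hs : 0 ≤ s) :
    0 ≤ stieltjesIntegrand y x s := by
  unfold stieltjesIntegrand
  have := Real.rpow_nonneg hs y
  positivity

lemma stieltjesIntegrand_eq {y x s : ℝ} (hx : x ∈ Set.Ioo (0 : ℝ) 1) (hs : 0 < s) :
    stieltjesIntegrand y x s =
      (Real.rpowIntegrand₀₁ y s 1 - Real.rpowIntegrand₀₁ y s x) * (1 - x)⁻¹ := by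
  have h1 : 1 - x ≠ 0 := by linarith [hx.2]
  have h2 : x + s ≠ 0 := by linarith [hx.1]
  have h2' : s + x ≠ 0 := by linarith [hx.1]
  have h3 : s + 1 ≠ 0 := by linarith
  have h3' : 1 + s ≠ 0 := by linarith
  unfold stieltjesIntegrand Real.rpowIntegrand₀₁
  field_simp
  ring

lemma integrableOn_stieltjesIntegrand {y x : ℝ} (hy : y ∈ Set.Ioo (0 : ℝ) 1)
    (hx : x ∈ Set.Ioo (0 : ℝ) 1) : IntegrableOn (stieltjesIntegrand y x) (Set.Ioi 0) := by
  have h := ((Real.integrableOn_rpowIntegrand₀₁_Ioi hy zero_le_one).sub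
    (Real.integrableOn_rpowIntegrand₀₁_Ioi hy hx.1.le)).mul_const (1 - x)⁻¹
  exact IntegrableOn.congr_fun h (fun s hs => (stieltjesIntegrand_eq hx hs).symm) measurableSet_Ioi

lemma eulerKernel_eq_stieltjes {y x : ℝ} (hy : y ∈ Set.Ioo (0 : ℝ) 1)
    (hx : x ∈ Set.Ioo (0 : ℝ) 1) :
    eulerKernel y x = stieltjesConst y * ∫ s in Set.Ioi (0 : ℝ), stieltjesIntegrand y x s := by
  have e : ∫ s in Set.Ioi (0 : ℝ), stieltjesIntegrand y x s =
      ∫ s in Set.Ioi (0 : ℝ),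
        (Real.rpowIntegrand₀₁ y s 1 - Real.rpowIntegrand₀₁ y s x) * (1 - x)⁻¹ :=
    setIntegral_congr_fun measurableSet_Ioi fun s hs => stieltjesIntegrand_eq hx hs
  have h1 := Real.rpow_eq_const_mul_integral hy hx.1.le
  have h2 := inv_mul_cancel₀ (Real.integral_rpowIntegrand₀₁_one_pos hy).ne'
  rw [e, integral_mul_const, integral_sub (Real.integrableOn_rpowIntegrand₀₁_Ioi hy zero_le_one)
    (Real.integrableOn_rpowIntegrand₀₁_Ioi hy hx.1.le), ← mul_assoc, mul_sub, stieltjesConst,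
    ← h1, h2, eulerKernel, div_eq_mul_inv]

/-- Lebesgue measure on the half-line of positive reals. -/
noncomputable def halfLineVolume : Measure ℝ := volume.restrict (Set.Ioi 0)

instance sFinite_halfLineVolume : SFinite halfLineVolume := by
  unfold halfLineVolume
  infer_instance

lemma ae_unitVolume_mem_Ioo : ∀ᵐ x ∂unitVolume, x ∈ Set.Ioo (0 : ℝ) 1 := by
  rw [unitVolume, ← Measure.restrict_congr_set Ioo_ae_eq_Ioc]
  exact ae_restrict_mem measurableSet_Ioo

lemma ae_prod_halfLine_mem : ∀ᵐ z ∂(unitVolume.prod halfLineVolume),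
    z.1 ∈ Set.Ioc (0 : ℝ) 1 ∧ z.2 ∈ Set.Ioi (0 : ℝ) := by
  rw [unitVolume, halfLineVolume, Measure.prod_restrict]
  exact ae_restrict_mem (measurableSet_Ioc.prod measurableSet_Ioi)

lemma measurable_stieltjesIntegrand (y : ℝ) :
    Measurable (fun z : ℝ × ℝ => stieltjesIntegrand y z.1 z.2) := by
  unfold stieltjesIntegrand
  fun_prop

lemma integral_stieltjesIntegrand_ae {y : ℝ} (hy : y ∈ Set.Ioo (0 : ℝ) 1) :
    (fun x => ∫ s, stieltjesIntegrand y x s ∂halfLineVolume) =ᵐ[unitVolume]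
      fun x => (stieltjesConst y)⁻¹ * eulerKernel y x := by
  filter_upwards [ae_unitVolume_mem_Ioo] with x hx
  rw [eulerKernel_eq_stieltjes hy hx, halfLineVolume,
    inv_mul_cancel_left₀ (stieltjesConst_pos hy).ne']

lemma integrable_eulerKernel {y : ℝ} (hy : y ∈ Set.Ioo (0 : ℝ) 1) :
    Integrable (eulerKernel y) unitVolume := by
  refine Integrable.of_bound
    (measurable_eulerKernel.comp measurable_prodMk_left).aestronglyMeasurable 1 ?_
  filter_upwards [ae_unitVolume_mem_Ioo] with x hx
  have h := eulerKernel_mem_Icc ⟨hy.1, hy.2.le⟩ ⟨hx.1, hx.2.le⟩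
  rw [Real.norm_of_nonneg h.1]
  exact h.2

lemma integrable_stieltjesIntegrand {y : ℝ} (hy : y ∈ Set.Ioo (0 : ℝ) 1) :
    Integrable (fun z : ℝ × ℝ => stieltjesIntegrand y z.1 z.2)
      (unitVolume.prod halfLineVolume) := by
  rw [integrable_prod_iff (measurable_stieltjesIntegrand y).aestronglyMeasurable]
  constructor
  · filter_upwards [ae_unitVolume_mem_Ioo] with x hx
    exact integrableOn_stieltjesIntegrand hy hx
  · refine ((integrable_eulerKernel hy).const_mul (stieltjesConst y)⁻¹).congr ?_
    filter_upwards [ae_unitVolume_mem_Ioo, integral_stieltjesIntegrand_ae hy] with x hx he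
    rw [← he, halfLineVolume]
    refine setIntegral_congr_fun measurableSet_Ioi fun s hs => ?_
    exact (Real.norm_of_nonneg (stieltjesIntegrand_nonneg y hx.1.le (le_of_lt hs))).symm

lemma integral_stieltjesIntegrand_le {y : ℝ} (hy : y ∈ Set.Ioo (0 : ℝ) 1) :
    stieltjesConst y * ∫ z, stieltjesIntegrand y z.1 z.2 ∂(unitVolume.prod halfLineVolume) ≤ 1 := by
  rw [integral_prod _ (integrable_stieltjesIntegrand hy),
    integral_congr_ae (integral_stieltjesIntegrand_ae hy), integral_const_mul,
    mul_inv_cancel_left₀ (stieltjesConst_pos hy).ne']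
  calc ∫ x, eulerKernel y x ∂unitVolume ≤ ∫ _x, (1 : ℝ) ∂unitVolume := by
        refine integral_mono_ae (integrable_eulerKernel hy) (integrable_const _) ?_
        filter_upwards [ae_unitVolume_mem_Ioo] with x hx
        exact (eulerKernel_mem_Icc ⟨hy.1, hy.2.le⟩ ⟨hx.1, hx.2.le⟩).2
    _ = 1 := by rw [integral_unitVolume]; simp

/-- Against the Cauchy kernel `1 / (x + s)` the factor `x^N` may be replaced by `(-s)^N`, the
difference being orthogonal to the Legendre polynomial. -/
lemma integral_pow_mul_legendreSum_div (n N : ℕ) (hN : N ≤ n) {s : ℝ} (hs : 0 < s) :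
    ∫ x in (0 : ℝ)..1, x ^ N * legendreSum n x / (x + s) =
      (-s) ^ N * ∫ x in (0 : ℝ)..1, x ^ n * (1 - x) ^ n / (x + s) ^ (n + 1) := by
  have hne : ∀ x ∈ Set.uIcc (0 : ℝ) 1, x + s ≠ 0 := fun x hx => by
    rw [Set.uIcc_of_le zero_le_one] at hx
    linarith [hx.1]
  have hc := continuous_legendreSum n
  induction N with
  | zero =>
    have h := integral_legendreSum_div n (show -1 < s⁻¹ by linarith [inv_pos.mpr hs])
    have e1 : ∫ x in (0 : ℝ)..1, legendreSum n x / (1 + s⁻¹ * x) =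
        s * ∫ x in (0 : ℝ)..1, x ^ 0 * legendreSum n x / (x + s) := by
      rw [← intervalIntegral.integral_const_mul]
      refine intervalIntegral.integral_congr fun x hx => ?_
      have := hne x hx
      have h2 : 1 + s⁻¹ * x = (x + s) / s := by field_simp; ring
      simp only [h2]
      field_simp
    have e2 : ∫ x in (0 : ℝ)..1, x ^ n * (1 - x) ^ n / (1 + s⁻¹ * x) ^ (n + 1) =
        s ^ (n + 1) * ∫ x in (0 : ℝ)..1, x ^ n * (1 - x) ^ n / (x + s) ^ (n + 1) := by
      rw [← intervalIntegral.integral_const_mul]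
      refine intervalIntegral.integral_congr fun x hx => ?_
      have := hne x hx
      have h2 : 1 + s⁻¹ * x = (x + s) / s := by field_simp; ring
      simp only [h2, div_pow]
      field_simp
    rw [e1, e2, inv_pow, pow_succ, mul_assoc, inv_mul_cancel_left₀ (by positivity)] at h
    rw [pow_zero, one_mul]
    exact mul_left_cancel₀ hs.ne' h
  | succ N ih =>
    have e : ∫ x in (0 : ℝ)..1, x ^ (N + 1) * legendreSum n x / (x + s) =
        ∫ x in (0 : ℝ)..1, (legendreSum n x * x ^ N +
          (-s) * (x ^ N * legendreSum n x / (x + s))) := by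
      refine intervalIntegral.integral_congr fun x hx => ?_
      have := hne x hx
      field_simp
      ring
    rw [e, intervalIntegral.integral_add (Continuous.intervalIntegrable (by fun_prop) _ _),
      integral_legendreSum_mul_pow n N (by omega), intervalIntegral.integral_const_mul,
      ih (by omega)]
    · ring
    · refine IntervalIntegrable.const_mul ?_ _
      apply ContinuousOn.intervalIntegrable
      exact ContinuousOn.div (by fun_prop) (by fun_prop) hne

/-- The positive integrand of the double integral that represents the remainder. -/
noncomputable def remainderIntegrand (n m : ℕ) (y x s : ℝ) : ℝ :=
  s ^ (n - m) * (x * (1 - x)) ^ n / (x + s) ^ n * stieltjesIntegrand y x s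

lemma remainderIntegrand_nonneg (n m : ℕ) (y : ℝ) {x s : ℝ} (hx : x ∈ Set.Ioc (0 : ℝ) 1)
    (hs : 0 < s) : 0 ≤ remainderIntegrand n m y x s := by
  have h1 := stieltjesIntegrand_nonneg y hx.1.le hs.le
  have h2 := sub_nonneg.mpr hx.2
  have h3 := hx.1
  unfold remainderIntegrand
  positivity

lemma remainderIntegrand_le {n m : ℕ} (h : m ≤ n) (y : ℝ) {x s : ℝ}
    (hx : x ∈ Set.Ioc (0 : ℝ) 1) (hs : 0 < s) :
    remainderIntegrand n m y x s ≤ (1 / 4) ^ (n - m) * stieltjesIntegrand y x s := by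
  have h1 := stieltjesIntegrand_nonneg y hx.1.le hs.le
  have h2 := sub_nonneg.mpr hx.2
  have h3 := hx.1
  refine mul_le_mul_of_nonneg_right ?_ h1
  have ha : x * (1 - x) ≤ 1 / 4 := by nlinarith [sq_nonneg (x - 1 / 2)]
  have hb : s / (x + s) ≤ 1 := (div_le_one (by linarith)).mpr (by linarith)
  have hc : x * (1 - x) / (x + s) ≤ 1 := (div_le_one (by linarith)).mpr (by nlinarith)
  obtain ⟨N, rfl⟩ := Nat.exists_eq_add_of_le h
  rw [Nat.add_sub_cancel_left]
  calc s ^ N * (x * (1 - x)) ^ (m + N) / (x + s) ^ (m + N)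
      = (s / (x + s)) ^ N * (x * (1 - x) / (x + s)) ^ m * (x * (1 - x)) ^ N := by
        rw [pow_add, pow_add, div_pow, div_pow]
        field_simp
    _ ≤ 1 * 1 * (1 / 4) ^ N := by
        gcongr
        · exact pow_le_one₀ (by positivity) hb
        · exact pow_le_one₀ (by positivity) hc
    _ = _ := by ring

lemma measurable_remainderIntegrand (n m : ℕ) (y : ℝ) :
    Measurable (fun z : ℝ × ℝ => remainderIntegrand n m y z.1 z.2) := by
  unfold remainderIntegrand
  exact Measurable.mul (by fun_prop) (measurable_stieltjesIntegrand y)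

lemma integrable_remainderIntegrand {n m : ℕ} (h : m ≤ n) {y : ℝ}
    (hy : y ∈ Set.Ioo (0 : ℝ) 1) :
    Integrable (fun z : ℝ × ℝ => remainderIntegrand n m y z.1 z.2)
      (unitVolume.prod halfLineVolume) := by
  refine ((integrable_stieltjesIntegrand hy).const_mul ((1 / 4) ^ (n - m))).mono'
    (measurable_remainderIntegrand n m y).aestronglyMeasurable ?_
  filter_upwards [ae_prod_halfLine_mem] with z hz
  rw [Real.norm_of_nonneg (remainderIntegrand_nonneg n m y hz.1 hz.2)]
  exact remainderIntegrand_le h y hz.1 hz.2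

/-- The part of the remainder that belongs to a single exponent `y`. -/
noncomputable def remainderSlice (n m : ℕ) (y : ℝ) : ℝ :=
  (-1) ^ n * ∫ x, (x ^ (n - m) * legendreSum n x) * eulerKernel y x ∂unitVolume

lemma remainderSlice_eq {n m : ℕ} (h : m ≤ n) {y : ℝ} (hy : y ∈ Set.Ioo (0 : ℝ) 1) :
    (-1) ^ m * remainderSlice n m y = stieltjesConst y *
      ∫ z, remainderIntegrand n m y z.1 z.2 ∂(unitVolume.prod halfLineVolume) := by
  have hf : Continuous (fun x => x ^ (n - m) * legendreSum n x) :=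
    (continuous_pow _).mul (continuous_legendreSum n)
  obtain ⟨B, hB⟩ := (isCompact_Icc (a := (0 : ℝ)) (b := 1)).exists_bound_of_continuousOn
    hf.continuousOn
  have hint : Integrable (fun z : ℝ × ℝ => (z.1 ^ (n - m) * legendreSum n z.1) *
      stieltjesIntegrand y z.1 z.2) (unitVolume.prod halfLineVolume) := by
    refine (integrable_stieltjesIntegrand hy).bdd_mul (c := B)
      (hf.measurable.comp measurable_fst).aestronglyMeasurable ?_
    filter_upwards [ae_prod_halfLine_mem] with z hz
    exact hB z.1 ⟨hz.1.1.le, hz.1.2⟩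
  have e1 : ∫ x, (x ^ (n - m) * legendreSum n x) * eulerKernel y x ∂unitVolume =
      stieltjesConst y * ∫ x, ∫ s, (x ^ (n - m) * legendreSum n x) *
        stieltjesIntegrand y x s ∂halfLineVolume ∂unitVolume := by
    rw [← integral_const_mul]
    refine integral_congr_ae ?_
    filter_upwards [integral_stieltjesIntegrand_ae hy] with x hx
    rw [integral_const_mul, hx]
    have := (stieltjesConst_pos hy).ne'
    field_simp
  have e2 : ∀ s ∈ Set.Ioi (0 : ℝ), ∫ x, (x ^ (n - m) * legendreSum n x) *
      stieltjesIntegrand y x s ∂unitVolume =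
      (-1) ^ (n - m) * ∫ x, remainderIntegrand n m y x s ∂unitVolume := fun s hs => by
    have hs' : (0 : ℝ) < s := hs
    have h0 := integral_pow_mul_legendreSum_div n (n - m) (Nat.sub_le n m) hs'
    rw [integral_unitVolume, integral_unitVolume]
    calc _ = s ^ y / (1 + s) * ∫ x in (0 : ℝ)..1, x ^ (n - m) * legendreSum n x / (x + s) := by
          rw [← intervalIntegral.integral_const_mul]
          refine intervalIntegral.integral_congr fun x hx => ?_
          simp only [stieltjesIntegrand, div_eq_mul_inv, mul_inv]
          ring
      _ = _ := by
          rw [h0, ← intervalIntegral.integral_const_mul, ← intervalIntegral.integral_const_mul,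
            ← intervalIntegral.integral_const_mul]
          refine intervalIntegral.integral_congr fun x hx => ?_
          simp only [remainderIntegrand, stieltjesIntegrand, div_eq_mul_inv, mul_inv, pow_succ,
            neg_pow s, mul_pow x]
          ring
  rw [remainderSlice, e1, integral_integral_swap hint,
    integral_prod_symm _ (integrable_remainderIntegrand h hy)]
  have e3 : ∫ s, ∫ x, (x ^ (n - m) * legendreSum n x) * stieltjesIntegrand y x s
      ∂unitVolume ∂halfLineVolume = ∫ s, (-1) ^ (n - m) *
        ∫ x, remainderIntegrand n m y x s ∂unitVolume ∂halfLineVolume := by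
    rw [halfLineVolume]
    exact setIntegral_congr_fun measurableSet_Ioi e2
  rw [e3, integral_const_mul]
  have hsign : (-1 : ℝ) ^ m * (-1) ^ n * (-1) ^ (n - m) = 1 := by
    rw [← pow_add, ← pow_add, show m + n + (n - m) = 2 * n by omega, pow_mul]
    norm_num
  linear_combination (stieltjesConst y * ∫ s, ∫ x, remainderIntegrand n m y x s
    ∂unitVolume ∂halfLineVolume) * hsign

lemma remainderSlice_le {n m : ℕ} (h : m ≤ n) {y : ℝ} (hy : y ∈ Set.Ioo (0 : ℝ) 1) :
    (-1) ^ m * remainderSlice n m y ≤ (1 / 4) ^ (n - m) := by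
  rw [remainderSlice_eq h hy]
  have h1 : ∫ z, remainderIntegrand n m y z.1 z.2 ∂(unitVolume.prod halfLineVolume) ≤
      (1 / 4) ^ (n - m) * ∫ z, stieltjesIntegrand y z.1 z.2 ∂(unitVolume.prod halfLineVolume) := by
    rw [← integral_const_mul]
    refine integral_mono_ae (integrable_remainderIntegrand h hy)
      ((integrable_stieltjesIntegrand hy).const_mul _) ?_
    filter_upwards [ae_prod_halfLine_mem] with z hz
    exact remainderIntegrand_le h y hz.1 hz.2
  calc _ ≤ stieltjesConst y * ((1 / 4) ^ (n - m) *
        ∫ z, stieltjesIntegrand y z.1 z.2 ∂(unitVolume.prod halfLineVolume)) :=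
        mul_le_mul_of_nonneg_left h1 (stieltjesConst_pos hy).le
    _ = (1 / 4) ^ (n - m) * (stieltjesConst y *
        ∫ z, stieltjesIntegrand y z.1 z.2 ∂(unitVolume.prod halfLineVolume)) := by ring
    _ ≤ (1 / 4) ^ (n - m) * 1 :=
        mul_le_mul_of_nonneg_left (integral_stieltjesIntegrand_le hy) (by positivity)
    _ = _ := mul_one _

lemma le_remainderIntegrand {n m : ℕ} (h : m ≤ n) {y x s : ℝ} (hy : 0 ≤ y)
    (hx : x ∈ Set.Icc (2 / 5 : ℝ) (3 / 5)) (hs : s ∈ Set.Icc (10 : ℝ) 11) :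
    (1 / 5) ^ n * ((1 / 11) ^ m / 144) ≤ remainderIntegrand n m y x s := by
  obtain ⟨hx1, hx2⟩ := hx
  obtain ⟨hs1, hs2⟩ := hs
  have hxs : 0 < x + s := by linarith
  have ha : 1 / 5 ≤ s * (x * (1 - x)) / (x + s) := by
    rw [le_div_iff₀ hxs]
    have : 6 / 25 ≤ x * (1 - x) := by nlinarith
    nlinarith
  have hb : 1 / 11 ≤ 1 / s := one_div_le_one_div_of_le (by linarith) hs2
  have hc : 1 / 144 ≤ stieltjesIntegrand y x s := by
    have : 1 ≤ s ^ y := Real.one_le_rpow (by linarith) hy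
    exact div_le_div₀ (by linarith) this (by positivity) (by nlinarith)
  have e : s ^ (n - m) * (x * (1 - x)) ^ n / (x + s) ^ n =
      (s * (x * (1 - x)) / (x + s)) ^ n * (1 / s) ^ m := by
    have : s ^ n = s ^ (n - m) * s ^ m := by rw [← pow_add, Nat.sub_add_cancel h]
    rw [div_pow, mul_pow s, this, one_div, inv_pow]
    field_simp
  unfold remainderIntegrand
  rw [e]
  calc _ = (1 / 5 : ℝ) ^ n * (1 / 11) ^ m * (1 / 144) := by ring
    _ ≤ _ := by gcongr

/-- The rectangle `[2/5, 3/5] × [10, 11]` alone contributes more than the Padé errors can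
cancel. -/
lemma le_remainderSlice {n m : ℕ} (h : m ≤ n) {y : ℝ} (hy : y ∈ Set.Ioo (0 : ℝ) 1) :
    stieltjesConst y * ((1 / 5) ^ n * ((1 / 11) ^ m / 720)) ≤ (-1) ^ m * remainderSlice n m y := by
  rw [remainderSlice_eq h hy]
  refine mul_le_mul_of_nonneg_left ?_ (stieltjesConst_pos hy).le
  set c : ℝ := (1 / 5) ^ n * ((1 / 11) ^ m / 144) with hc
  set A : Set (ℝ × ℝ) := Set.Icc (2 / 5 : ℝ) (3 / 5) ×ˢ Set.Icc (10 : ℝ) 11 with hA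
  have hAm : MeasurableSet A := measurableSet_Icc.prod measurableSet_Icc
  have hvol : (unitVolume.prod halfLineVolume).real A = 1 / 5 := by
    rw [hA, measureReal_prod_prod, unitVolume, halfLineVolume,
      measureReal_restrict_apply measurableSet_Icc, measureReal_restrict_apply measurableSet_Icc,
      Set.inter_eq_left.mpr (show Set.Icc (2 / 5 : ℝ) (3 / 5) ⊆ Set.Ioc 0 1 from
        Set.Icc_subset_Ioc (by norm_num) (by norm_num)),
      Set.inter_eq_left.mpr (show Set.Icc (10 : ℝ) 11 ⊆ Set.Ioi 0 from
        fun s hs => lt_of_lt_of_le (by norm_num) hs.1)]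
    simp only [Real.volume_real_Icc]
    norm_num
  calc (1 / 5) ^ n * ((1 / 11) ^ m / 720) = (unitVolume.prod halfLineVolume).real A * c := by
        rw [hvol, hc]; ring
    _ = ∫ _z in A, c ∂(unitVolume.prod halfLineVolume) := by
        rw [setIntegral_const, smul_eq_mul]
    _ ≤ ∫ z in A, remainderIntegrand n m y z.1 z.2 ∂(unitVolume.prod halfLineVolume) := by
        refine setIntegral_mono_on ?_ (integrable_remainderIntegrand h hy).integrableOn hAm
          fun z hz => le_remainderIntegrand h hy.1.le hz.1 hz.2
        refine integrableOn_const ?_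
        intro htop
        rw [measureReal_def, htop] at hvol
        norm_num at hvol
    _ ≤ _ := by
        refine setIntegral_le_integral (integrable_remainderIntegrand h hy) ?_
        filter_upwards [ae_prod_halfLine_mem] with z hz
        exact remainderIntegrand_nonneg n m y hz.1 hz.2

lemma exists_le_stieltjesConst :
    ∃ c : ℝ, 0 < c ∧ ∀ y ∈ Set.Icc (1 / 4 : ℝ) (3 / 4), c ≤ stieltjesConst y := by
  have h1 : (1 / 4 : ℝ) ∈ Set.Ioo (0 : ℝ) 1 := by norm_num
  have h3 : (3 / 4 : ℝ) ∈ Set.Ioo (0 : ℝ) 1 := by norm_num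
  have hi1 := Real.integrableOn_rpowIntegrand₀₁_Ioi h1 zero_le_one
  have hi3 := Real.integrableOn_rpowIntegrand₀₁_Ioi h3 zero_le_one
  refine ⟨((∫ t in Set.Ioi (0 : ℝ), Real.rpowIntegrand₀₁ (1 / 4) t 1) +
    ∫ t in Set.Ioi (0 : ℝ), Real.rpowIntegrand₀₁ (3 / 4) t 1)⁻¹,
    inv_pos.mpr (add_pos (Real.integral_rpowIntegrand₀₁_one_pos h1)
      (Real.integral_rpowIntegrand₀₁_one_pos h3)), fun y hy => ?_⟩
  have hy' : y ∈ Set.Ioo (0 : ℝ) 1 := ⟨by linarith [hy.1], by linarith [hy.2]⟩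
  refine inv_anti₀ (Real.integral_rpowIntegrand₀₁_one_pos hy') ?_
  rw [← integral_add hi1 hi3]
  refine setIntegral_mono_on (Real.integrableOn_rpowIntegrand₀₁_Ioi hy' zero_le_one)
    (hi1.add hi3) measurableSet_Ioi fun t ht => ?_
  have ht0 : (0 : ℝ) < t := ht
  have hn : 0 ≤ t⁻¹ - (t + 1)⁻¹ := sub_nonneg.mpr (inv_anti₀ ht0 (by linarith))
  simp only [Real.rpowIntegrand₀₁]
  rw [← add_mul]
  refine mul_le_mul_of_nonneg_right ?_ hn
  -- `t^y ≤ t^(1/4) + t^(3/4)`, by comparing exponents on either side of `t = 1`.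
  have hp1 := Real.rpow_nonneg ht0.le (1 / 4)
  have hp3 := Real.rpow_nonneg ht0.le (3 / 4)
  rcases le_total t 1 with h | h
  · have := Real.rpow_le_rpow_of_exponent_ge ht0 h hy.1
    linarith
  · have := Real.rpow_le_rpow_of_exponent_le h hy.2
    linarith

lemma eulerRemainder_eq_integral (n m : ℕ) :
    eulerRemainder n m = ∫ y, remainderSlice n m y ∂unitVolume := by
  have hf : Continuous (fun x => x ^ (n - m) * legendreSum n x) :=
    (continuous_pow _).mul (continuous_legendreSum n)
  rw [eulerRemainder, integral_prod _ (integrable_continuous_mul_eulerKernel hf),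
    ← integral_const_mul]
  rfl

lemma integrable_remainderSlice (n m : ℕ) : Integrable (remainderSlice n m) unitVolume :=
  (integrable_continuous_mul_eulerKernel ((continuous_pow (n - m)).mul
    (continuous_legendreSum n))).integral_prod_left.const_mul _

lemma eulerRemainder_le {n m : ℕ} (h : m ≤ n) :
    (-1) ^ m * eulerRemainder n m ≤ (1 / 4) ^ (n - m) := by
  rw [eulerRemainder_eq_integral, ← integral_const_mul]
  calc _ ≤ ∫ _y, (1 / 4 : ℝ) ^ (n - m) ∂unitVolume := by
        refine integral_mono_ae ((integrable_remainderSlice n m).const_mul _)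
          (integrable_const _) ?_
        filter_upwards [ae_unitVolume_mem_Ioo] with y hy
        exact remainderSlice_le h hy
    _ = _ := by rw [integral_unitVolume]; simp

/-- The remainder has the sign `(-1)^m` and is not exponentially smaller than `5^(-n)`. -/
lemma exists_le_eulerRemainder (m : ℕ) : ∃ c : ℝ, 0 < c ∧ ∀ n : ℕ, m ≤ n →
    c * (1 / 5) ^ n ≤ (-1) ^ m * eulerRemainder n m := by
  obtain ⟨c, hc, hC⟩ := exists_le_stieltjesConst
  refine ⟨1 / 2 * (c * ((1 / 11) ^ m / 720)), by positivity, fun n h => ?_⟩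
  set B : Set ℝ := Set.Icc (1 / 4 : ℝ) (3 / 4) with hB
  have hint := (integrable_remainderSlice n m).const_mul ((-1) ^ m)
  have hvol : unitVolume.real B = 1 / 2 := by
    rw [hB, unitVolume, measureReal_restrict_apply measurableSet_Icc,
      Set.inter_eq_left.mpr (show Set.Icc (1 / 4 : ℝ) (3 / 4) ⊆ Set.Ioc 0 1 from
        Set.Icc_subset_Ioc (by norm_num) (by norm_num)),
      Real.volume_real_Icc]
    norm_num
  rw [eulerRemainder_eq_integral, ← integral_const_mul]
  calc _ = ∫ _y in B, c * ((1 / 5) ^ n * ((1 / 11) ^ m / 720)) ∂unitVolume := by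
        rw [setIntegral_const, hvol, smul_eq_mul]; ring
    _ ≤ ∫ y in B, (-1) ^ m * remainderSlice n m y ∂unitVolume := by
        refine setIntegral_mono_on (integrable_const _) hint.integrableOn measurableSet_Icc
          fun y hy => ?_
        refine le_trans ?_ (le_remainderSlice h ⟨by linarith [hy.1], by linarith [hy.2]⟩)
        exact mul_le_mul_of_nonneg_right (hC y hy) (by positivity)
    _ ≤ _ := by
        refine setIntegral_le_integral hint ?_
        filter_upwards [ae_unitVolume_mem_Ioo] with y hy
        refine le_trans ?_ (le_remainderSlice h hy)
        have := stieltjesConst_pos hy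
        positivity

/-! ### Growth of the least common multiple -/

lemma lcmUpTo_eq_lcmUpto (n : ℕ) : lcmUpTo n = Nat.lcmUpto n := rfl

lemma lcmUpTo_ne_zero (n : ℕ) : lcmUpTo n ≠ 0 := Nat.lcmUpto_ne_zero n

lemma dvd_lcmUpTo {n k : ℕ} (hk : 1 ≤ k) (hkn : k ≤ n) : k ∣ lcmUpTo n :=
  Finset.dvd_lcm (f := id) (Finset.mem_Icc.mpr ⟨hk, hkn⟩)

lemma lcmUpTo_mono {a b : ℕ} (h : a ≤ b) : lcmUpTo a ≤ lcmUpTo b :=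
  Nat.le_of_dvd (Nat.pos_of_ne_zero (lcmUpTo_ne_zero b))
    (Finset.lcm_dvd fun i hi => by
      obtain ⟨h1, h2⟩ := Finset.mem_Icc.mp hi
      exact dvd_lcmUpTo h1 (h2.trans h))

/-- The step function `⌊6y⌋ - ⌊3y⌋ - ⌊2y⌋ - ⌊y⌋` is non-negative, and positive for
`1 / 6 ≤ y < 1`. -/
lemma indicator_add_floor_le (k q : ℕ) (hq : 0 < q) :
    (if q ≤ 6 * k then 1 else 0) + (3 * k / q + 2 * k / q + k / q) ≤
      (if q ≤ k then 1 else 0) + 6 * k / q := by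
  have e3 := Nat.div_mul_le_self (3 * k) q
  have e2 := Nat.div_mul_le_self (2 * k) q
  have e1 := Nat.div_mul_le_self k q
  have hsum : 3 * k / q + 2 * k / q + k / q ≤ 6 * k / q := by
    rw [Nat.le_div_iff_mul_le hq]
    nlinarith
  by_cases h1 : q ≤ k
  · have : q ≤ 6 * k := by omega
    simp only [h1, this, if_true]
    omega
  · have hk : k / q = 0 := Nat.div_eq_of_lt (by omega)
    by_cases h6 : q ≤ 6 * k
    · simp only [h1, h6, if_true, if_false, hk]
      have ha : 3 * k / q < 3 := (Nat.div_lt_iff_lt_mul hq).mpr (by omega)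
      have hb : 2 * k / q < 2 := (Nat.div_lt_iff_lt_mul hq).mpr (by omega)
      have g1 : 1 ≤ 6 * k / q := by rw [Nat.le_div_iff_mul_le hq]; omega
      have g3 : 2 * (3 * k / q) ≤ 6 * k / q := by
        rw [Nat.le_div_iff_mul_le hq]
        nlinarith
      have g2 : 3 * (2 * k / q) ≤ 6 * k / q := by
        rw [Nat.le_div_iff_mul_le hq]
        nlinarith
      omega
    · simp only [h1, h6, if_false]
      omega

lemma log_eq_sum_indicator {p n b : ℕ} (hp : p.Prime) (hb : Nat.log p n < b) :
    Nat.log p n = ∑ i ∈ Finset.Ico 1 b, if p ^ i ≤ n then 1 else 0 := by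
  rcases Nat.eq_zero_or_pos n with rfl | hn
  · simp [hp.ne_zero]
  rw [← Finset.sum_filter, Finset.sum_const, smul_eq_mul, mul_one]
  have : (Finset.Ico 1 b).filter (fun i => p ^ i ≤ n) = Finset.Icc 1 (Nat.log p n) := by
    ext i
    simp only [Finset.mem_filter, Finset.mem_Ico, Finset.mem_Icc]
    rw [← Nat.le_log_iff_pow_le hp.one_lt hn.ne']
    omega
  rw [this]
  simp

/-- A Chebyshev-type divisibility: primes between `k` and `6k` divide the multinomial coefficient
`(6k)! / ((3k)! (2k)! k!)`. -/
lemma lcmUpTo_mul_factorials_dvd (k : ℕ) :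
    lcmUpTo (6 * k) * ((3 * k)! * (2 * k)! * k !) ∣ lcmUpTo k * (6 * k)! := by
  have hl := lcmUpTo_ne_zero
  have hf := Nat.factorial_ne_zero
  rw [← Nat.factorization_prime_le_iff_dvd
    (mul_ne_zero (hl _) (mul_ne_zero (mul_ne_zero (hf _) (hf _)) (hf _)))
    (mul_ne_zero (hl _) (hf _))]
  intro p hp
  obtain ⟨b, hb⟩ : ∃ b, Nat.log p (6 * k) < b := ⟨_, Nat.lt_succ_self _⟩
  have hb' : ∀ a ≤ 6 * k, Nat.log p a < b := fun a ha =>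
    (Nat.log_mono_right ha).trans_lt hb
  rw [Nat.factorization_mul (hl _) (mul_ne_zero (mul_ne_zero (hf _) (hf _)) (hf _)),
    Nat.factorization_mul (mul_ne_zero (hf _) (hf _)) (hf _),
    Nat.factorization_mul (hf _) (hf _), Nat.factorization_mul (hl _) (hf _)]
  simp only [Finsupp.add_apply, lcmUpTo_eq_lcmUpto, Nat.factorization_lcmUpto _ hp]
  rw [Nat.factorization_factorial hp (hb' (3 * k) (by omega)),
    Nat.factorization_factorial hp (hb' (2 * k) (by omega)),
    Nat.factorization_factorial hp (hb' k (by omega)),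
    Nat.factorization_factorial hp (hb' (6 * k) le_rfl),
    log_eq_sum_indicator hp (hb' (6 * k) le_rfl), log_eq_sum_indicator hp (hb' k (by omega)),
    ← Finset.sum_add_distrib, ← Finset.sum_add_distrib, ← Finset.sum_add_distrib,
    ← Finset.sum_add_distrib]
  exact Finset.sum_le_sum fun i _ => indicator_add_floor_le k (p ^ i) (pow_pos hp.pos i)

lemma factorial_six_mul_le (k : ℕ) :
    (6 * k)! ≤ 432 ^ k * ((3 * k)! * (2 * k)! * k !) := by
  induction k with
  | zero => simp
  | succ k ih =>
    have e6 : (6 * (k + 1))! = (6 * k + 6) * (6 * k + 5) * (6 * k + 4) * (6 * k + 3) *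
        (6 * k + 2) * (6 * k + 1) * (6 * k)! := by
      rw [show 6 * (k + 1) = 6 * k + 5 + 1 by ring]
      simp only [Nat.factorial_succ]
      ring
    have e3 : (3 * (k + 1))! = (3 * k + 3) * (3 * k + 2) * (3 * k + 1) * (3 * k)! := by
      rw [show 3 * (k + 1) = 3 * k + 2 + 1 by ring]
      simp only [Nat.factorial_succ]
      ring
    have e2 : (2 * (k + 1))! = (2 * k + 2) * (2 * k + 1) * (2 * k)! := by
      rw [show 2 * (k + 1) = 2 * k + 1 + 1 by ring]
      simp only [Nat.factorial_succ]
      ring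
    rw [e6, e3, e2, Nat.factorial_succ, pow_succ]
    have hpoly : (6 * k + 6) * (6 * k + 5) * (6 * k + 4) * (6 * k + 3) * (6 * k + 2) * (6 * k + 1)
        ≤ 432 * (((3 * k + 3) * (3 * k + 2) * (3 * k + 1)) * ((2 * k + 2) * (2 * k + 1)) *
          (k + 1)) := by
      have : (6 * k + 5) * (6 * k + 1) ≤ (6 * k + 6) * (6 * k + 6) := by nlinarith
      calc _ = 24 * (k + 1) * (3 * k + 2) * (3 * k + 1) * (6 * k + 3) *
            ((6 * k + 5) * (6 * k + 1)) := by ring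
        _ ≤ 24 * (k + 1) * (3 * k + 2) * (3 * k + 1) * (6 * k + 3) *
            ((6 * k + 6) * (6 * k + 6)) := by gcongr
        _ = _ := by ring
    calc _ ≤ _ := Nat.mul_le_mul hpoly ih
      _ = _ := by ring

lemma lcmUpTo_six_mul_le (k : ℕ) : lcmUpTo (6 * k) ≤ lcmUpTo k * 432 ^ k := by
  have h1 := Nat.le_of_dvd (Nat.mul_pos (Nat.pos_of_ne_zero (lcmUpTo_ne_zero k))
    (Nat.factorial_pos _)) (lcmUpTo_mul_factorials_dvd k)
  have h2 := Nat.mul_le_mul_left (lcmUpTo k) (factorial_six_mul_le k)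
  have hpos : 0 < (3 * k)! * (2 * k)! * k ! := by positivity
  refine Nat.le_of_mul_le_mul_right ?_ hpos
  calc _ ≤ _ := h1
    _ ≤ _ := h2
    _ = _ := by ring

/-- A bound `d_n = O(c^n)` with `c < 4`. The recursion `d_{6k} ≤ 432^k d_k` yields it for every
`c` with `c^5 > 432`. -/
lemma exists_lcmUpTo_le : ∃ C : ℝ, 0 < C ∧ ∀ n : ℕ, (lcmUpTo n : ℝ) ≤ C * (7 / 2) ^ n := by
  obtain ⟨K, hK⟩ : ∃ K : ℕ, (7 / 2 : ℝ) ^ 6 * (432 / (7 / 2) ^ 5) ^ (K + 1) ≤ 1 := by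
    have ht : Tendsto (fun K : ℕ => (7 / 2 : ℝ) ^ 6 * (432 / (7 / 2) ^ 5) ^ (K + 1)) atTop
        (𝓝 ((7 / 2 : ℝ) ^ 6 * 0)) :=
      ((tendsto_pow_atTop_nhds_zero_of_lt_one (by norm_num) (by norm_num)).comp
        (tendsto_add_atTop_nat 1)).const_mul _
    rw [mul_zero] at ht
    exact (ht.eventually_le_const one_pos).exists
  refine ⟨((lcmUpTo (6 * K + 6) : ℕ) : ℝ), by exact_mod_cast Nat.pos_of_ne_zero (lcmUpTo_ne_zero _), ?_⟩
  intro n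
  induction n using Nat.strong_induction_on with
  | _ n ih =>
    rcases le_or_gt n (6 * K + 6) with hn | hn
    · have h1 : (lcmUpTo n : ℝ) ≤ lcmUpTo (6 * K + 6) := by exact_mod_cast lcmUpTo_mono hn
      refine h1.trans (le_mul_of_one_le_right (Nat.cast_nonneg _) (one_le_pow₀ (by norm_num)))
    -- Rounding `n` up to `6 (k + 1)` loses at most `(7/2)^6`, which `K` was chosen to absorb.
    · obtain ⟨k, hk1, hk2⟩ : ∃ k, n ≤ 6 * (k + 1) ∧ 6 * k ≤ n :=
        ⟨n / 6, by omega, by omega⟩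
      have hKk : K ≤ k := by omega
      have h1 : (lcmUpTo n : ℝ) ≤ lcmUpTo (k + 1) * 432 ^ (k + 1) := by
        exact_mod_cast (lcmUpTo_mono hk1).trans (lcmUpTo_six_mul_le (k + 1))
      set C : ℝ := ((lcmUpTo (6 * K + 6) : ℕ) : ℝ) with hC
      have hq : (7 / 2 : ℝ) ^ 6 * (432 / (7 / 2) ^ 5) ^ (k + 1) ≤ 1 := by
        refine le_trans ?_ hK
        gcongr ?_ * ?_
        exact pow_le_pow_of_le_one (by norm_num) (by norm_num) (by omega)
      calc (lcmUpTo n : ℝ) ≤ lcmUpTo (k + 1) * 432 ^ (k + 1) := h1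
        _ ≤ (C * (7 / 2) ^ (k + 1)) * 432 ^ (k + 1) := by
          gcongr
          exact ih (k + 1) (by omega)
        _ = C * (7 / 2) ^ (6 * k) * ((7 / 2 : ℝ) ^ 6 * (432 / (7 / 2) ^ 5) ^ (k + 1)) := by
          rw [mul_assoc, ← mul_pow, mul_assoc, ← mul_assoc _ _ ((432 / (7 / 2) ^ 5 : ℝ) ^ (k + 1)),
            ← pow_add, show 6 * k + 6 = 6 * (k + 1) by ring, pow_mul, ← mul_pow]
          norm_num
        _ ≤ C * (7 / 2) ^ (6 * k) * 1 := by gcongr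
        _ ≤ C * (7 / 2) ^ n := by
          rw [mul_one]
          gcongr
          norm_num

/-! ### The irrationality criterion -/

lemma exists_int_lcmUpTo_mul_harmonic {n k : ℕ} (h : k ≤ n) :
    ∃ z : ℤ, (lcmUpTo n : ℝ) * (harmonic k : ℝ) = z := by
  induction k with
  | zero => exact ⟨0, by simp⟩
  | succ k ih =>
    obtain ⟨z, hz⟩ := ih (by omega)
    obtain ⟨w, hw⟩ := dvd_lcmUpTo (Nat.succ_pos k) h
    refine ⟨z + w, ?_⟩
    have hw' : (lcmUpTo n : ℝ) = ((k : ℝ) + 1) * w := by rw [hw]; push_cast; ring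
    have hk : (k : ℝ) + 1 ≠ 0 := by positivity
    rw [harmonic_succ]
    push_cast
    rw [mul_add, hz, hw']
    field_simp

lemma exists_int_lcmUpTo_mul_harmonicForm (n : ℕ) :
    ∃ z : ℤ, (lcmUpTo n : ℝ) * harmonicForm n = z := by
  have h : ∀ k ∈ Finset.range (n + 1), ∃ z : ℤ, (lcmUpTo n : ℝ) * (harmonic k : ℝ) = z :=
    fun k hk => exists_int_lcmUpTo_mul_harmonic (by
      have := Finset.mem_range.mp hk
      omega)
  choose! z hz using h
  refine ⟨∑ k ∈ Finset.range (n + 1),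
    (n.choose k : ℤ) * ((n + k).choose k : ℤ) * (-1) ^ (n + k) * z k, ?_⟩
  rw [harmonicForm, Finset.mul_sum]
  push_cast
  refine Finset.sum_congr rfl fun k hk => ?_
  rw [← hz k hk]
  ring

lemma tendsto_fract_of_eq_int_add {x ε : ℕ → ℝ} (hx : ∀ᶠ p in atTop, ∃ z : ℤ, x p = z + ε p)
    (hε : ∀ᶠ p in atTop, 0 ≤ ε p) (hlim : Tendsto ε atTop (𝓝 0)) :
    Tendsto (fun p => Int.fract (x p)) atTop (𝓝 0) := by
  refine hlim.congr' ?_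
  filter_upwards [hx, hε, hlim.eventually_lt_const one_pos] with p ⟨z, hz⟩ h0 h1
  rw [hz, Int.fract_intCast_add, Int.fract_eq_self.mpr ⟨h0, h1⟩]

lemma exists_int_lcmUpTo_mul_rat (q : ℚ) {n : ℕ} (h : q.den ≤ n) :
    ∃ z : ℤ, (lcmUpTo n : ℝ) * (q : ℝ) = z := by
  obtain ⟨w, hw⟩ := dvd_lcmUpTo q.pos h
  refine ⟨w * q.num, ?_⟩
  have hq : (q : ℝ) * q.den = q.num := by exact_mod_cast Rat.mul_den_eq_num q
  rw [hw]
  push_cast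
  rw [← hq]
  ring

/-- The amount by which `d (-1)^m ratForm n m p`, with `d = lcmUpTo N`, exceeds some integer when
`γ` is rational. -/
noncomputable def fractError (m n N p : ℕ) : ℝ :=
  (lcmUpTo N : ℝ) * ((-1) ^ m * eulerRemainder n m +
    (-1) ^ m * ((ratForm n m p : ℝ) - logForm n m))

lemma exists_int_add_fractError {q : ℚ} (hq : Real.eulerMascheroniConstant = q) {m n N : ℕ}
    (p : ℕ) (hm : m ≤ n) (hN : n ≤ N) (hqn : q.den ≤ n) :
    ∃ z : ℤ, (lcmUpTo N : ℝ) * (-1) ^ m * (ratForm n m p : ℝ) = z + fractError m n N p := by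
  obtain ⟨a, ha⟩ := exists_int_lcmUpTo_mul_harmonicForm n
  obtain ⟨b, hb⟩ := exists_int_lcmUpTo_mul_rat q hqn
  obtain ⟨w, hw⟩ : lcmUpTo n ∣ lcmUpTo N := Finset.lcm_dvd fun i hi => by
    obtain ⟨h1, h2⟩ := Finset.mem_Icc.mp hi
    exact dvd_lcmUpTo h1 (h2.trans hN)
  refine ⟨(-1) ^ m * w * (a - b), ?_⟩
  have hR := eulerRemainder_eq n m hm
  rw [hq] at hR
  rw [fractError, hR, hw]
  push_cast
  rw [← ha, ← hb]
  ring

/-- If `γ` is rational, then `fractError` is non-negative, because the remainder of the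
approximation to `γ` has a known sign and outweighs the Padé errors; and it tends to `0`, because
`lcm(1, …, n)` grows more slowly than `4^n`. -/
lemma fractError_bounds (m : ℕ) (N : ℕ → ℕ) (hN : ∀ p, N p ≤ 2 ^ p + m - 1 + 1) :
    (∀ᶠ p in atTop, 0 ≤ fractError m (2 ^ p + m - 1) (N p) p) ∧
      Tendsto (fun p => fractError m (2 ^ p + m - 1) (N p) p) atTop (𝓝 0) := by
  obtain ⟨c, hc, hlow⟩ := exists_le_eulerRemainder m
  obtain ⟨C, hC, hlcm⟩ := exists_lcmUpTo_le
  have ht := tendsto_two_pow_add_sub_one m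
  have hpow : Tendsto (fun n : ℕ => (2 : ℝ) * (189 / 200) ^ n) atTop (𝓝 0) := by
    simpa using (tendsto_pow_atTop_nhds_zero_of_lt_one (r := (189 / 200 : ℝ)) (by norm_num)
      (by norm_num)).const_mul 2
  have hsmall := ht.eventually (hpow.eventually_le_const hc)
  have hn : ∀ p : ℕ, 2 ^ p + m - 1 + 1 = 2 ^ p + m := fun p => by
    have := Nat.two_pow_pos p
    omega
  have hmn : ∀ p : ℕ, m ≤ 2 ^ p + m - 1 := fun p => by
    have := Nat.two_pow_pos p
    omega
  have habs : ∀ᶠ p : ℕ in atTop, |(-1) ^ m * ((ratForm (2 ^ p + m - 1) m p : ℝ) -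
      logForm (2 ^ p + m - 1) m)| ≤ 2 * (189 / 1000) ^ (2 ^ p + m - 1) := by
    filter_upwards [eventually_abs_logForm_sub_ratForm_le m] with p hp
    rw [abs_mul, abs_pow, abs_neg, abs_one, one_pow, one_mul, abs_sub_comm]
    exact hp _ (hn p)
  have hnonneg : ∀ᶠ p in atTop, 0 ≤ fractError m (2 ^ p + m - 1) (N p) p := by
    filter_upwards [hsmall, habs] with p h1 h2
    set n := 2 ^ p + m - 1 with hndef
    refine mul_nonneg (Nat.cast_nonneg _) ?_
    have h3 := hlow n (hmn p)
    have h4 : 2 * (189 / 1000 : ℝ) ^ n ≤ c * (1 / 5) ^ n := by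
      calc 2 * (189 / 1000 : ℝ) ^ n = 2 * (189 / 200) ^ n * (1 / 5) ^ n := by
            rw [mul_assoc, ← mul_pow]; norm_num
        _ ≤ _ := by gcongr
    linarith [neg_le_of_abs_le h2]
  refine ⟨hnonneg, ?_⟩
  have hlim : Tendsto (fun p : ℕ => C * (7 / 2) * ((4 ^ m + 2) * (7 / 8 : ℝ) ^ (2 ^ p + m - 1)))
      atTop (𝓝 0) := by
    simpa using (((tendsto_pow_atTop_nhds_zero_of_lt_one (r := (7 / 8 : ℝ)) (by norm_num)
      (by norm_num)).comp ht).const_mul (4 ^ m + 2 : ℝ)).const_mul (C * (7 / 2))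
  refine tendsto_of_tendsto_of_tendsto_of_le_of_le' tendsto_const_nhds hlim hnonneg ?_
  filter_upwards [habs] with p h2
  have hNp := hN p
  have hmp := hmn p
  set n := 2 ^ p + m - 1 with hndef
  have h3 := eulerRemainder_le hmp
  have h4 : (1 / 4 : ℝ) ^ (n - m) = 4 ^ m * (1 / 4) ^ n := by
    conv_rhs => rw [← Nat.sub_add_cancel hmp, pow_add, mul_left_comm, ← mul_pow]
    norm_num
  have h5 : (189 / 1000 : ℝ) ^ n ≤ (1 / 4) ^ n :=
    pow_le_pow_left₀ (by norm_num) (by norm_num) n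
  have h6 : (-1) ^ m * eulerRemainder n m + (-1) ^ m * ((ratForm n m p : ℝ) - logForm n m) ≤
      (4 ^ m + 2) * (1 / 4) ^ n := by
    linarith [le_of_abs_le h2]
  have h7 : (lcmUpTo (N p) : ℝ) ≤ C * (7 / 2) ^ (n + 1) := by
    refine (hlcm _).trans ?_
    gcongr
    norm_num
  calc fractError m n (N p) p ≤ (lcmUpTo (N p) : ℝ) * ((4 ^ m + 2) * (1 / 4) ^ n) :=
        mul_le_mul_of_nonneg_left h6 (Nat.cast_nonneg _)
    _ ≤ C * (7 / 2) ^ (n + 1) * ((4 ^ m + 2) * (1 / 4) ^ n) := by gcongr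
    _ = C * (7 / 2) * ((4 ^ m + 2) * (7 / 8 : ℝ) ^ n) := by
        rw [show (7 / 8 : ℝ) = 7 / 2 * (1 / 4) by norm_num, mul_pow (7 / 2 : ℝ), pow_succ]
        ring

theorem irrational_eulerMascheroniConstant_of_not_tendsto (m : ℕ) (N : ℕ → ℕ)
    (hN : ∀ p, 2 ^ p + m - 1 ≤ N p ∧ N p ≤ 2 ^ p + m - 1 + 1)
    (h : ¬ Tendsto (fun p : ℕ => Int.fract ((lcmUpTo (N p) : ℝ) * (-1) ^ m *
      (ratForm (2 ^ p + m - 1) m p : ℝ))) atTop (𝓝 0)) :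
    Irrational Real.eulerMascheroniConstant := by
  rintro ⟨q, hq⟩
  obtain ⟨h0, hlim⟩ := fractError_bounds m N fun p => (hN p).2
  refine h (tendsto_fract_of_eq_int_add ?_ h0 hlim)
  filter_upwards [(tendsto_two_pow_add_sub_one m).eventually_ge_atTop q.den] with p hp
  refine exists_int_add_fractError hq.symm p ?_ (hN p).1 hp
  have := Nat.two_pow_pos p
  omega

theorem mainTheorem4 :
    (∀ n : ℕ, IsPadeApproximant (fun t : ℝ => Real.log (1 + t)) n n
      ((padeNum n).map (algebraMap ℚ ℝ)) ((padeDen n).map (algebraMap ℚ ℝ))) ∧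
    (∀ m : ℕ, ∀ᶠ p : ℕ in atTop, ∀ n : ℕ, n + 1 = 2 ^ p + m →
      |logForm n m - (ratForm n m p : ℝ)| ≤ ((4 : ℝ) ^ n)⁻¹ / (n : ℝ)) ∧
    (∀ m p n : ℕ, m ≤ 1 → 1 ≤ n → n + 1 = 2 ^ p + m →
      |logForm n m - (ratForm n m p : ℝ)| ≤ ((4 : ℝ) ^ n)⁻¹ / (n : ℝ)) ∧
    (∀ m : ℕ,
      ¬ Tendsto (fun p : ℕ => Int.fract ((lcmUpTo (2 ^ p + m - 1) : ℝ) * (-1) ^ m *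
          (ratForm (2 ^ p + m - 1) m p : ℝ))) atTop (𝓝 0) →
        Irrational Real.eulerMascheroniConstant) ∧
    (∀ m : ℕ, m ≤ 1 →
      ¬ Tendsto (fun p : ℕ => Int.fract ((lcmUpTo (2 ^ p) : ℝ) * (-1) ^ m *
          (ratForm (2 ^ p + m - 1) m p : ℝ))) atTop (𝓝 0) →
        Irrational Real.eulerMascheroniConstant) :=
  ⟨isPadeApproximant_log, eventually_abs_logForm_sub_ratForm_le_inv,
    abs_logForm_sub_ratForm_le_of_le_one,
    fun m => irrational_eulerMascheroniConstant_of_not_tendsto m (fun p => 2 ^ p + m - 1)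
      fun _ => ⟨le_rfl, Nat.le_succ _⟩,
    fun m hm => irrational_eulerMascheroniConstant_of_not_tendsto m (fun p => 2 ^ p)
      fun p => by
        have := Nat.two_pow_pos p
        constructor <;> omega⟩
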